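/- Let $k\ge 3$ and $m\ge 5$ be integers. All hypergraphs are finite, without repeated edges, and $k$-uniform: every edge is a set of exactly $k$ vertices. A hypergraph is *linear* if any two distinct edges share at most one vertex. It is *bicyclic* if it is connected and its cyclomatic number $m(k-1)-n+l$ equals $2$, where $n$, $m$, $l$ are its numbers of vertices, edges and connected components. The *adjacency tensor* $\mathcal A=(a_{i_1\cdots i_k})$ of a hypergraph $G$ has $a_{i_1\cdots i_k}=\frac1{(k-1)!}$ if $\{i_1,\dots,i_k\}$ is an edge and $a_{i_1\cdots i_k}=0$ otherwise. A number $\lambda\in\mathbb C$ is an *eigenvalue* of $\mathcal A$ if there is a nonzero complex vector $x$ with $\sum_{i_2,\dots,i_k} a_{i i_2\cdots i_k}x_{i_2}\cdots x_{i_k}=\lambda x_i^{k-1}$ for all vertices $i$, and the *spectral radius* $\rho(G)$ is the largest modulus of an eigenvalue of $\mathcal A$. The $k$-th *power* of a simple graph is the $k$-uniform hypergraph obtained by adding $k-2$ new vertices to each edge (different new vertices for different edges). The *hyperstar* $K_{1,s}$ is the $k$-th power of the star with $s$ edges; *attaching* it at a vertex $v$ of a hypergraph means identifying its center with $v$. Let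 $G_5$ be the $k$-uniform hypergraph with four edges $e,f_1,f_2,f_3$ in which $e$ contains the vertices $v_1,v_2,v_3$, the edge $f_i$ contains $w$ and $v_i$ for $i=1,2,3$ (where $w\notin e$), and every other vertex lies in exactly one edge; so $w$ has degree $3$ and $v_1,v_2,v_3$ have degree $2$. Let $G_{10}$ be the $k$-th power of the graph $K_4$ minus an edge. Define - $B_m^L(1)$: $G_5$ with a hyperstar $K_{1,m-4}$ attached at the vertex $w$ of degree $3$; - $B_m^L(2)$: $G_5$ with a hyperstar $K_{1,m-4}$ attached at a vertex of degree $2$; - $B_m^P$: $G_{10}$ with a hyperstar $K_{1,m-5}$ attached at a vertex of degree $3$ (so $B_5^P=G_{10}$). **Theorem.** Among all linear bicyclic $k$-uniform hypergraphs with $m$ edges, the spectral radius attains its maximum, and every hypergraph that attains this maximum is isomorphic to $B_m^L(1)$, $B_m^L(2)$ or $B_m^P$. -/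

import Mathlib

universe u

/-- A real tensor of order `k` on the index set `ι`. The first index is kept apart from the
remaining `k - 1` indices: `T i t` is the entry `t_{i i₂ … i_k}` with `t = (i₂, …, i_k)`. -/
abbrev HyperTensor (k : ℕ) (ι : Type*) := ι → (Fin (k - 1) → ι) → ℝ

namespace HyperTensor

/-- `lam` is an eigenvalue of `T`: `T x^{k-1} = lam x^{[k-1]}` for some nonzero complex `x`. -/
def IsEigenvalue {k : ℕ} {ι : Type*} [Fintype ι] (T : HyperTensor k ι) (lam : ℂ) : Prop :=
  ∃ x : ι → ℂ, x ≠ 0 ∧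
    ∀ i : ι, ∑ t : Fin (k - 1) → ι, (T i t : ℂ) * ∏ j, x (t j) = lam * x i ^ (k - 1)

/-- The spectral radius of a tensor: the largest modulus of an eigenvalue. -/
noncomputable def spectralRadius {k : ℕ} {ι : Type*} [Fintype ι] (T : HyperTensor k ι) : ℝ :=
  sSup {r : ℝ | ∃ lam : ℂ, T.IsEigenvalue lam ∧ r = ‖lam‖}

end HyperTensor

namespace Hypergraph

/-- Every edge has exactly `k` vertices (used for `k ≥ 3`, so that edges are finite). -/
def IsUniform {α : Type*} (G : Hypergraph α) (k : ℕ) : Prop :=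
  ∀ e ∈ G.edgeSet, e.ncard = k

/-- Two distinct edges have at most one common vertex. -/
def IsLinear {α : Type*} (G : Hypergraph α) : Prop :=
  ∀ e ∈ G.edgeSet, ∀ f ∈ G.edgeSet, e ≠ f → (e ∩ f).Subsingleton

/-- The relation "`u` and `v` are joined by a walk" on the vertices of `G`: consecutive vertices
of a walk lie in a common edge. -/
def walkSetoid {α : Type*} (G : Hypergraph α) : Setoid G.vertexSet where
  r u v := Relation.ReflTransGen G.Adj (u : α) (v : α)
  iseqv :=
    { refl := fun _ => Relation.ReflTransGen.refl
      symm := fun h => by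
        have hs : Std.Symm G.Adj := ⟨fun _ _ h => h.symm⟩
        exact Std.Symm.symm (r := Relation.ReflTransGen G.Adj) _ _ h
      trans := fun h₁ h₂ => h₁.trans h₂ }

/-- The number of connected components. -/
noncomputable def numComponents {α : Type*} (G : Hypergraph α) : ℕ :=
  Nat.card (Quotient G.walkSetoid)

/-- Nonempty, and every two vertices are joined by a walk. -/
def IsConnected {α : Type*} (G : Hypergraph α) : Prop :=
  G.vertexSet.Nonempty ∧
    ∀ u ∈ G.vertexSet, ∀ v ∈ G.vertexSet, Relation.ReflTransGen G.Adj u v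

/-- The cyclomatic number `m (k - 1) - n + l` of a `k`-uniform hypergraph with `n` vertices,
`m` edges and `l` connected components. -/
noncomputable def cyclomaticNumber {α : Type*} (G : Hypergraph α) (k : ℕ) : ℤ :=
  (G.edgeSet.ncard : ℤ) * ((k : ℤ) - 1) - (G.vertexSet.ncard : ℤ) + (G.numComponents : ℤ)

/-- Connected with cyclomatic number `2`. -/
def IsBicyclic {α : Type*} (G : Hypergraph α) (k : ℕ) : Prop :=
  G.IsConnected ∧ G.cyclomaticNumber k = 2

open Classical in
/-- The adjacency tensor of a `k`-uniform hypergraph: the entry at `i₁, …, i_k` is `1 / (k - 1)!`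
if `{i₁, …, i_k}` is an edge, and `0` otherwise. -/
noncomputable def adjTensor {α : Type*} (G : Hypergraph α) (k : ℕ) :
    HyperTensor k G.vertexSet := fun i t =>
  if insert (i : α) (Set.range fun j => (t j : α)) ∈ G.edgeSet then
    1 / (Nat.factorial (k - 1) : ℝ)
  else 0

/-- The spectral radius of a finite `k`-uniform hypergraph. -/
noncomputable def spectralRadius {α : Type*} (G : Hypergraph α) [Finite G.vertexSet] (k : ℕ) : ℝ :=
  letI := Fintype.ofFinite G.vertexSet
  (G.adjTensor k).spectralRadius

/-- The class of (finite) linear bicyclic `k`-uniform hypergraphs with `m` edges. -/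
structure IsLinearBicyclic {α : Type*} (G : Hypergraph α) (k m : ℕ) : Prop where
  finite : G.vertexSet.Finite
  uniform : G.IsUniform k
  linear : G.IsLinear
  bicyclic : G.IsBicyclic k
  card_edges : G.edgeSet.ncard = m

/-- `G` attains the maximum spectral radius among all linear bicyclic `k`-uniform hypergraphs
with `m` edges. -/
def IsMaximizingLinearBicyclic {α : Type u} (G : Hypergraph α) [Finite G.vertexSet]
    (k m : ℕ) : Prop :=
  G.IsLinearBicyclic k m ∧
    ∀ (β : Type u) (H : Hypergraph β) [Finite H.vertexSet],
      H.IsLinearBicyclic k m → H.spectralRadius k ≤ G.spectralRadius k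

/-- Isomorphism of hypergraphs: a bijection between the vertex sets that preserves edges and
non-edges. -/
def IsIsomorphic {α β : Type*} (G : Hypergraph α) (H : Hypergraph β) : Prop :=
  ∃ φ : G.vertexSet ≃ H.vertexSet, ∀ s : Set G.vertexSet,
    (fun x => (x : α)) '' s ∈ G.edgeSet ↔ (fun x => (φ x : β)) '' s ∈ H.edgeSet

/-- The `k`-th power of a simple graph: each edge `e` is enlarged by `k - 2` new vertices. -/
def power {V : Type*} (S : SimpleGraph V) (k : ℕ) :
    Hypergraph (V ⊕ (S.edgeSet × Fin (k - 2))) where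
  vertexSet := Set.univ
  edgeSet := Set.range fun e : S.edgeSet =>
    Sum.inl '' {v : V | v ∈ (e : Sym2 V)} ∪ Set.range fun j : Fin (k - 2) => Sum.inr (e, j)
  subset_vertexSet_of_mem_edgeSet' := fun _ _ => Set.subset_univ _

/-- The `k`-uniform hyperstar with `m` edges, the `k`-th power of the star `K_{1,m}`. -/
def hyperstar (k m : ℕ) := power (completeBipartiteGraph (Fin 1) (Fin m)) k

/-- The center of the hyperstar. -/
def hyperstarCenter (k m : ℕ) :
    (Fin 1 ⊕ Fin m) ⊕ ((completeBipartiteGraph (Fin 1) (Fin m)).edgeSet × Fin (k - 2)) :=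
  Sum.inl (Sum.inl 0)

open Classical in
/-- The map that sends `u` to `v` and keeps all other points apart. -/
noncomputable def glue {α β : Type*} (v : α) (u : β) (x : β) : α ⊕ {y : β // y ≠ u} :=
  if h : x = u then Sum.inl v else Sum.inr ⟨x, h⟩

/-- The hypergraph obtained from the disjoint union of `G` and `H` by identifying the vertex `v`
of `G` with the vertex `u` of `H`, that is, by attaching `H` with its root `u` at `v`. -/
def coalescence {α β : Type*} (G : Hypergraph α) (v : α) (H : Hypergraph β) (u : β) :
    Hypergraph (α ⊕ {y : β // y ≠ u}) where
  vertexSet := (G.image Sum.inl).vertexSet ∪ (H.image (glue v u)).vertexSet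
  edgeSet := (G.image Sum.inl).edgeSet ∪ (H.image (glue v u)).edgeSet
  subset_vertexSet_of_mem_edgeSet' := by
    rintro e (he | he)
    · exact (subset_vertexSet_of_mem_edgeSet he).trans Set.subset_union_left
    · exact (subset_vertexSet_of_mem_edgeSet he).trans Set.subset_union_right

/-- The hypergraph obtained from `G` by attaching the hyperstar with `s` edges with its center
at `v`. -/
def attachHyperstar {α : Type*} (G : Hypergraph α) (v : α) (k s : ℕ) :=
  coalescence G v (hyperstar k s) (hyperstarCenter k s)

/-- The vertices of `G₅`: the vertex `w` of degree 3, the vertices `v 0, v 1, v 2` of degree 2,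
and the vertices of degree 1. -/
inductive G5Vertex (k : ℕ) : Type
  | w : G5Vertex k
  | v (i : Fin 3) : G5Vertex k
  | core (j : Fin (k - 3)) : G5Vertex k
  | spoke (i : Fin 3) (j : Fin (k - 2)) : G5Vertex k

/-- The `k`-uniform hypergraph `G₅` with four edges: one edge containing `v 0, v 1, v 2`, and for
each `i` an edge containing `w` and `v i`; all further vertices lie in exactly one edge. -/
def G5 (k : ℕ) : Hypergraph (G5Vertex k) where
  vertexSet := Set.univ
  edgeSet := {Set.range G5Vertex.v ∪ Set.range G5Vertex.core} ∪
    Set.range fun i : Fin 3 => {G5Vertex.w, G5Vertex.v i} ∪ Set.range (G5Vertex.spoke i)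
  subset_vertexSet_of_mem_edgeSet' := fun _ _ => Set.subset_univ _

/-- `K₄` minus the edge `{2, 3}`; the vertices `0` and `1` have degree 3. -/
def diamond : SimpleGraph (Fin 4) := (⊤ : SimpleGraph (Fin 4)).deleteEdges {s(2, 3)}

/-- The `k`-uniform hypergraph `G₁₀`, the `k`-th power of `K₄` minus an edge. -/
def G10 (k : ℕ) := power diamond k

/-- `B_m^L(1)`: the hyperstar is attached at the vertex of degree 3 of `G₅`. -/
def BL1 (k m : ℕ) := attachHyperstar (G5 k) G5Vertex.w k (m - 4)

/-- `B_m^L(2)`: the hyperstar is attached at a vertex of degree 2 of `G₅` (the vertices of degree 2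
are `v 0, v 1, v 2`, and they are permuted transitively by the automorphisms of `G₅`). -/
def BL2 (k m : ℕ) := attachHyperstar (G5 k) (G5Vertex.v 0) k (m - 4)

/-- `B_m^P`: the hyperstar is attached at a vertex of degree 3 of `G₁₀` (the two vertices of
degree 3 are exchanged by an automorphism). For `m = 5` this is `G₁₀` itself. -/
def BP (k m : ℕ) := attachHyperstar (G10 k) (Sum.inl 0) k (m - 5)

end Hypergraph

/-! ### Edge polynomials and Perron vectors -/

namespace EdgeFamily

/-! For a connected `k`-uniform family the spectral radius is the maximum of `k * edgeSum E y / ∑ v,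
y v ^ k` over nonzero nonnegative `y`. The maximum is attained by compactness; a maximizer `x`
satisfies the eigenvalue equation and is positive, and the triangle inequality bounds every complex
eigenvalue by the maximum (`exists_isPerron`, `IsPerron.linkSum_eq`, `IsPerron.pos`,
`IsPerron.spectralRadius_eq`).

Replace a vertex `v` of an edge `f` by a vertex `u` outside `f` with `x v ≤ x u`. The form at `x`
does not decrease, while the link of `v` loses a positive term, so `x` is no longer an eigenvector
and the radius strictly grows. In a maximal hypergraph such a move must therefore leave the class.
If `v` still reaches `u` without `f`, only linearity can fail: some edge contains `u` and another
vertex of `f` (`IsMaximal.exists_obstruction`).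

Let `u` carry the largest entry. Two applications show that each edge off `u` contains at least two
neighbours of `u`. The edges through `u` meet only in `u`, so with `r` edges off `u` and `m * (k -
1) - 1` vertices in all, exactly `r * (k - 1) - 2` vertices other than `u` are not neighbours of
`u`. Each edge off `u` contains at most `k - 2` of them, hence `1 ≤ r ≤ 2`. For `r = 1` the edge has
exactly three neighbours of `u`: this is `G5` with its degree-3 vertex at `u`. For `r = 2` equality
holds throughout, so each of the two edges has exactly two neighbours of `u`, and any common vertex
is such a neighbour. Disjoint edges are excluded by a further move, towards the largest of the four
neighbours. If the edges share a neighbour, the two remaining neighbours lie on one edge through `u`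
(`G5` with a degree-2 vertex at `u`) or on two (`G10` with a degree-3 vertex at `u`). All other
edges form a hyperstar at `u`.

A uniform hypergraph is determined up to isomorphism by the incidences of finitely many chosen
vertices when every other vertex has degree one (`IsSkeleton.isIsomorphic`); this turns the
incidence patterns into the named hypergraphs. A maximizer exists because the number of vertices is
fixed, so only finitely many radii occur. -/

/-- The sum of the edge monomials of a family of finite sets. -/
def edgeSum {V R : Type*} [CommSemiring R] (E : Finset (Finset V)) (x : V → R) : R :=
  ∑ e ∈ E, ∏ v ∈ e, x v

/-- The partial derivative of `edgeSum` in direction `i`. -/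
def linkSum {V R : Type*} [DecidableEq V] [CommSemiring R] (E : Finset (Finset V)) (x : V → R)
    (i : V) : R :=
  ∑ e ∈ E with i ∈ e, ∏ v ∈ e.erase i, x v

section Algebra

variable {V R : Type*} [DecidableEq V] [CommSemiring R] {E : Finset (Finset V)}

theorem mul_linkSum (x : V → R) (i : V) :
    x i * linkSum E x i = ∑ e ∈ E with i ∈ e, ∏ v ∈ e, x v := by
  rw [linkSum, Finset.mul_sum]
  refine Finset.sum_congr rfl fun e he => ?_
  exact Finset.mul_prod_erase e x (Finset.mem_filter.1 he).2

theorem sum_mul_linkSum [Fintype V] {k : ℕ} (hE : ∀ e ∈ E, e.card = k) (x : V → R) :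
    ∑ i, x i * linkSum E x i = k * edgeSum E x := by
  simp_rw [mul_linkSum, Finset.sum_filter]
  rw [Finset.sum_comm, edgeSum, Finset.mul_sum]
  refine Finset.sum_congr rfl fun e he => ?_
  rw [← Finset.sum_filter]
  simp [hE e he]

theorem edgeSum_update (x : V → R) (i : V) (t : R) :
    edgeSum E (Function.update x i t) =
      t * linkSum E x i + ∑ e ∈ E with i ∉ e, ∏ v ∈ e, x v := by
  rw [edgeSum, ← Finset.sum_filter_add_sum_filter_not E (fun e => i ∈ e), linkSum, Finset.mul_sum]
  congr 1
  · refine Finset.sum_congr rfl fun e he => ?_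
    have hi := (Finset.mem_filter.1 he).2
    rw [← Finset.mul_prod_erase e _ hi, Function.update_self]
    congr 1
    refine Finset.prod_congr rfl fun v hv => ?_
    rw [Function.update_of_ne (Finset.ne_of_mem_erase hv)]
  · refine Finset.sum_congr rfl fun e he => Finset.prod_congr rfl fun v hv => ?_
    have hi := (Finset.mem_filter.1 he).2
    rw [Function.update_of_ne]
    rintro rfl
    exact hi hv

end Algebra

theorem edgeSum_smul {V R : Type*} [CommSemiring R] {E : Finset (Finset V)} {k : ℕ}
    (hE : ∀ e ∈ E, e.card = k) (c : R) (x : V → R) :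
    edgeSum E (fun v => c * x v) = c ^ k * edgeSum E x := by
  rw [edgeSum, edgeSum, Finset.mul_sum]
  refine Finset.sum_congr rfl fun e he => ?_
  rw [Finset.prod_mul_distrib, Finset.prod_const, hE e he]

theorem edgeSum_nonneg {V : Type*} {E : Finset (Finset V)} {y : V → ℝ} (h : ∀ v, 0 ≤ y v) :
    0 ≤ edgeSum E y :=
  Finset.sum_nonneg fun _ _ => Finset.prod_nonneg fun v _ => h v

/-- `x` is a nonnegative nonzero vector at which `k * edgeSum E y / ∑ v, y v ^ k` attains its
maximum `ρ` over the nonnegative vectors. -/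
structure IsPerron {V : Type*} [Fintype V] (E : Finset (Finset V)) (k : ℕ) (ρ : ℝ)
    (x : V → ℝ) : Prop where
  nonneg : ∀ v, 0 ≤ x v
  ne_zero : x ≠ 0
  bound : ∀ y : V → ℝ, (∀ v, 0 ≤ y v) → k * edgeSum E y ≤ ρ * ∑ v, y v ^ k
  attained : k * edgeSum E x = ρ * ∑ v, x v ^ k

section Perron

variable {V : Type*} [Fintype V] {E : Finset (Finset V)} {k : ℕ} {ρ : ℝ} {x : V → ℝ}

theorem sum_pow_pos {y : V → ℝ} (h : ∀ v, 0 ≤ y v) (hy : y ≠ 0) : 0 < ∑ v, y v ^ k := by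
  obtain ⟨v, hv⟩ := Function.ne_iff.1 hy
  exact Finset.sum_pos' (fun v _ => pow_nonneg (h v) k)
    ⟨v, Finset.mem_univ v, pow_pos (lt_of_le_of_ne (h v) (Ne.symm hv)) k⟩

theorem IsPerron.value_nonneg (h : IsPerron E k ρ x) : 0 ≤ ρ := by
  have h1 := sum_pow_pos (k := k) h.nonneg h.ne_zero
  have h2 : 0 ≤ ρ * ∑ v, x v ^ k := by
    rw [← h.attained]
    exact mul_nonneg k.cast_nonneg (edgeSum_nonneg h.nonneg)
  exact nonneg_of_mul_nonneg_left h2 h1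

theorem exists_isPerron [Nonempty V] (hk : k ≠ 0) (hE : ∀ e ∈ E, e.card = k) :
    ∃ ρ x, IsPerron E k ρ x := by
  classical
  set K : Set (V → ℝ) := {y | (∀ v, 0 ≤ y v) ∧ ∑ v, y v ^ k = 1} with hK
  have hcl : IsClosed K := by
    have h1 : K = (⋂ v, {y : V → ℝ | 0 ≤ y v}) ∩ {y | ∑ v, y v ^ k = 1} := by
      ext y; simp [hK]
    rw [h1]
    refine (isClosed_iInter fun v => isClosed_le continuous_const (continuous_apply v)).inter
      (isClosed_eq (by fun_prop) continuous_const)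
  have hsub : K ⊆ Set.Icc (fun _ => 0) (fun _ => 1) := by
    rintro y ⟨h0, h1⟩
    refine ⟨h0, fun v => ?_⟩
    have h2 : y v ^ k ≤ 1 := h1 ▸
      Finset.single_le_sum (f := fun v => y v ^ k) (fun v _ => pow_nonneg (h0 v) k)
        (Finset.mem_univ v)
    exact (pow_le_one_iff_of_nonneg (h0 v) hk).1 h2
  have hcomp : IsCompact K := isCompact_Icc.of_isClosed_subset hcl hsub
  have hne : K.Nonempty := by
    obtain ⟨v⟩ := ‹Nonempty V›
    refine ⟨Pi.single v 1, fun w => ?_, ?_⟩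
    · by_cases h : w = v
      · subst h; simp
      · simp [h]
    · rw [Finset.sum_eq_single v]
      · simp
      · intro w _ h; simp [h, hk]
      · simp
  obtain ⟨x, hx, hmax⟩ := hcomp.exists_isMaxOn hne
    (f := fun y => (k : ℝ) * edgeSum E y) (by unfold edgeSum; fun_prop)
  refine ⟨k * edgeSum E x, x, hx.1, ?_, fun y hy => ?_, by rw [hx.2, mul_one]⟩
  · rintro rfl
    have := hx.2
    simp [hk] at this
  · by_cases hy0 : y = 0
    · subst hy0
      have h0 : edgeSum E (0 : V → ℝ) = 0 := by
        refine Finset.sum_eq_zero fun e he => ?_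
        simp [hE e he, hk]
      simp [h0, hk]
    · set s := ∑ v, y v ^ k with hs
      have hspos : 0 < s := sum_pow_pos hy hy0
      set c := s ^ (k : ℝ)⁻¹ with hc
      have hcpos : 0 < c := Real.rpow_pos_of_pos hspos _
      -- Both sides of the bound are homogeneous of degree `k`, so scaling by the `k`-th root of `s`
      -- moves `y` into `K`.
      have hck : c ^ k = s := Real.rpow_inv_natCast_pow hspos.le hk
      have hmem : (fun v => c⁻¹ * y v) ∈ K := by
        refine ⟨fun v => mul_nonneg (inv_nonneg.2 hcpos.le) (hy v), ?_⟩
        simp_rw [mul_pow]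
        rw [← Finset.mul_sum, ← hs, inv_pow, hck, inv_mul_cancel₀ hspos.ne']
      have h1 : (k : ℝ) * edgeSum E (fun v => c⁻¹ * y v) ≤ k * edgeSum E x := hmax hmem
      rw [edgeSum_smul hE, inv_pow, hck] at h1
      have h2 := mul_le_mul_of_nonneg_right h1 hspos.le
      calc (k : ℝ) * edgeSum E y = k * (s⁻¹ * edgeSum E y) * s := by field_simp
        _ ≤ _ := h2

theorem IsPerron.le_of_edgeSum_le {E' : Finset (Finset V)} {ρ' : ℝ} {y : V → ℝ}
    (h : IsPerron E k ρ x) (h' : IsPerron E' k ρ' y) (hle : edgeSum E x ≤ edgeSum E' x) :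
    ρ ≤ ρ' := by
  have h1 := sum_pow_pos (k := k) h.nonneg h.ne_zero
  have h2 := h'.bound x h.nonneg
  have h3 : (k : ℝ) * edgeSum E x ≤ k * edgeSum E' x :=
    mul_le_mul_of_nonneg_left hle k.cast_nonneg
  rw [h.attained] at h3
  exact le_of_mul_le_mul_right (h3.trans h2) h1

theorem IsPerron.value_unique {ρ' : ℝ} {y : V → ℝ}
    (h : IsPerron E k ρ x) (h' : IsPerron E k ρ' y) : ρ = ρ' :=
  le_antisymm (h.le_of_edgeSum_le h' le_rfl) (h'.le_of_edgeSum_le h le_rfl)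

variable [DecidableEq V]

/-- The eigenvalue equation, as first-order optimality condition. -/
theorem IsPerron.linkSum_eq (hk : 2 ≤ k) (h : IsPerron E k ρ x) (i : V) :
    linkSum E x i = ρ * x i ^ (k - 1) := by
  have hk0 : (0 : ℝ) < k := by positivity
  set L := linkSum E x i with hL
  set B := ∑ e ∈ E with i ∉ e, ∏ v ∈ e, x v with hB
  set A := ∑ v ∈ Finset.univ.erase i, x v ^ k with hA
  have hsum : ∀ t : ℝ, ∑ v, Function.update x i t v ^ k = t ^ k + A := by
    intro t
    rw [← Finset.add_sum_erase _ _ (Finset.mem_univ i), Function.update_self, hA]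
    congr 1
    exact Finset.sum_congr rfl fun v hv => by
      rw [Function.update_of_ne (Finset.ne_of_mem_erase hv)]
  -- Varying only the coordinate `i` gives a one-variable inequality that is an equality at `t = x
  -- i`: an interior minimum if `x i > 0`, and a limit `t → 0` otherwise.
  have hb : ∀ t : ℝ, 0 ≤ t → k * (t * L + B) ≤ ρ * (t ^ k + A) := by
    intro t ht
    have h1 := h.bound (Function.update x i t) fun v => by
      by_cases hv : v = i
      · subst hv; simpa using ht
      · simpa [hv] using h.nonneg v
    rwa [edgeSum_update, hsum] at h1
  have heq : k * (x i * L + B) = ρ * (x i ^ k + A) := by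
    have h1 := h.attained
    rw [← Function.update_eq_self i x] at h1
    rwa [edgeSum_update, hsum] at h1
  rcases (h.nonneg i).eq_or_lt with h0 | hpos
  · have hLnn : 0 ≤ L := Finset.sum_nonneg fun e _ => Finset.prod_nonneg fun v _ => h.nonneg v
    rw [← h0, zero_pow (by omega)] at heq
    have hle : ∀ t : ℝ, 0 < t → k * L ≤ ρ * t ^ (k - 1) := by
      intro t ht
      have h1 := hb t ht.le
      have h2 : t ^ k = t * t ^ (k - 1) := by rw [← pow_succ']; congr 1; omega
      have h3 : t * (k * L) ≤ t * (ρ * t ^ (k - 1)) := by rw [h2] at h1; linarith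
      exact le_of_mul_le_mul_left h3 ht
    have hlim : Filter.Tendsto (fun t : ℝ => ρ * t ^ (k - 1)) (nhdsWithin 0 (Set.Ioi 0))
        (nhds (ρ * 0 ^ (k - 1))) :=
      ((continuous_const.mul (continuous_pow (k - 1))).tendsto 0).mono_left nhdsWithin_le_nhds
    have h1 := ge_of_tendsto hlim (Filter.eventually_of_mem self_mem_nhdsWithin hle)
    rw [zero_pow (by omega), mul_zero] at h1
    rw [← h0, zero_pow (by omega), mul_zero]
    nlinarith
  · have hmin : IsLocalMin (fun t : ℝ => ρ * (t ^ k + A) - k * (t * L + B)) (x i) := by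
      filter_upwards [lt_mem_nhds hpos] with t ht
      have := hb t ht.le
      linarith
    have hder : HasDerivAt (fun t : ℝ => ρ * (t ^ k + A) - k * (t * L + B))
        (ρ * (k * x i ^ (k - 1)) - k * (1 * L)) (x i) :=
      (((hasDerivAt_pow k (x i)).add_const A).const_mul ρ).sub
        ((((hasDerivAt_id (x i)).mul_const L).add_const B).const_mul (k : ℝ))
    have h1 := hmin.hasDerivAt_eq_zero hder
    have h2 : (k : ℝ) * (ρ * x i ^ (k - 1) - L) = 0 := by linarith
    have h3 := (mul_eq_zero.1 h2).resolve_left hk0.ne'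
    linarith

/-- If the values agreed, `x` would be a maximizer for `E'` too, and both link sums at `i` would
equal `ρ * x i ^ (k - 1)`. -/
theorem IsPerron.lt_of_edgeSum_le (hk : 2 ≤ k) {E' : Finset (Finset V)} {ρ' : ℝ} {y : V → ℝ}
    (h : IsPerron E k ρ x) (h' : IsPerron E' k ρ' y) (hle : edgeSum E x ≤ edgeSum E' x)
    {i : V} (hi : linkSum E' x i ≠ linkSum E x i) : ρ < ρ' := by
  refine lt_of_le_of_ne (h.le_of_edgeSum_le h' hle) ?_
  rintro rfl
  have hx : IsPerron E' k ρ x :=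
    ⟨h.nonneg, h.ne_zero, h'.bound, le_antisymm (h'.bound x h.nonneg) (by
      rw [← h.attained]; exact mul_le_mul_of_nonneg_left hle k.cast_nonneg)⟩
  exact hi (by rw [hx.linkSum_eq hk, h.linkSum_eq hk])

/-- Two vertices are linked if they lie in a common edge. -/
def Linked {V : Type*} (E : Finset (Finset V)) (a b : V) : Prop := ∃ e ∈ E, a ∈ e ∧ b ∈ e

/-- Otherwise connectedness gives an edge with zero and nonzero entries. Raising its zeros to `ε`
gains order `ε ^ Z.card` in the edge sum and costs only order `ε ^ k` in the norm, where `Z.card <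
k`; this beats the maximum for small `ε`. -/
theorem IsPerron.pos (hE : ∀ e ∈ E, e.card = k) (h : IsPerron E k ρ x)
    (hconn : ∀ a b, Relation.ReflTransGen (Linked E) a b) (q : V) : 0 < x q := by
  obtain ⟨p, hp⟩ := Function.ne_iff.1 h.ne_zero
  by_contra hq
  have hq0 : x q = 0 := le_antisymm (not_lt.1 hq) (h.nonneg q)
  have hcross : ∃ e ∈ E, ∃ a ∈ e, ∃ b ∈ e, x a ≠ 0 ∧ x b = 0 := by
    by_contra hno
    push Not at hno
    have : ∀ b, Relation.ReflTransGen (Linked E) p b → x b ≠ 0 := by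
      intro b hb
      induction hb with
      | refl => exact hp
      | tail _ hs ih =>
        obtain ⟨e, he, ha, hb⟩ := hs
        exact hno e he _ ha _ hb ih
    exact this q (hconn p q) hq0
  obtain ⟨e, he, a, ha, b, hb, hxa, hxb⟩ := hcross
  set Z := e.filter fun v => x v = 0 with hZ
  set P := e.filter fun v => ¬ x v = 0 with hP
  set c := ∏ v ∈ P, x v with hc
  have hcpos : 0 < c := Finset.prod_pos fun v hv =>
    lt_of_le_of_ne (h.nonneg v) (Ne.symm (Finset.mem_filter.1 hv).2)
  have hcard : Z.card + P.card = k := by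
    rw [← hE e he]; exact Finset.card_filter_add_card_filter_not _
  have hPpos : 0 < P.card := Finset.card_pos.2 ⟨a, by simp [hP, ha, hxa]⟩
  have hk0 : 0 < k := by omega
  have key : ∀ ε : ℝ, 0 < ε → (k : ℝ) * c ≤ ρ * (Z.card * ε ^ P.card) := by
    intro ε hε
    set y : V → ℝ := fun v => if v ∈ Z then ε else x v with hy
    have hxy : ∀ v, x v ≤ y v := by
      intro v
      by_cases hv : v ∈ Z
      · simp only [hy, hv, if_true, (Finset.mem_filter.1 hv).2, hε.le]
      · simp [hy, hv]
    have hy0 : ∀ v, 0 ≤ y v := fun v => (h.nonneg v).trans (hxy v)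
    have hye : ∏ v ∈ e, y v = ε ^ Z.card * c := by
      rw [← Finset.prod_filter_mul_prod_filter_not e (fun v => x v = 0)]
      congr 1
      · rw [Finset.prod_congr rfl (g := fun _ => ε)]
        · simp [hZ]
        · intro v hv; simp only [hy, hZ, hv, if_true]
      · refine Finset.prod_congr rfl fun v hv => ?_
        have : v ∉ Z := fun hz => (Finset.mem_filter.1 hv).2 (Finset.mem_filter.1 hz).2
        simp [hy, this]
    have h1 : edgeSum E x + ε ^ Z.card * c ≤ edgeSum E y := by
      rw [edgeSum, edgeSum, ← Finset.add_sum_erase _ _ he,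
        ← Finset.add_sum_erase E (fun e => ∏ v ∈ e, y v) he, hye, Finset.prod_eq_zero hb hxb, zero_add, add_comm]
      gcongr with f hf v hv
      · intro v _; exact h.nonneg v
      · exact hxy v
    have h2 : ∑ v, y v ^ k = ∑ v, x v ^ k + Z.card * ε ^ k := by
      have : ∀ v, y v ^ k = x v ^ k + if v ∈ Z then ε ^ k else 0 := by
        intro v
        by_cases hv : v ∈ Z
        · simp only [hy, hv, if_true, (Finset.mem_filter.1 hv).2, zero_pow hk0.ne', zero_add]
        · simp [hy, hv]
      simp_rw [this]
      rw [Finset.sum_add_distrib, Finset.sum_ite_mem]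
      simp
    have h3 := h.bound y hy0
    rw [h2] at h3
    have h4 : (k : ℝ) * (edgeSum E x + ε ^ Z.card * c) ≤ k * edgeSum E y :=
      mul_le_mul_of_nonneg_left h1 k.cast_nonneg
    have h5 := h.attained
    have h6 : ε ^ k = ε ^ Z.card * ε ^ P.card := by rw [← pow_add, hcard]
    have h7 : ε ^ Z.card * (k * c) ≤ ε ^ Z.card * (ρ * (Z.card * ε ^ P.card)) := by
      rw [h6] at h3; linarith
    exact le_of_mul_le_mul_left h7 (pow_pos hε _)
  have hlim : Filter.Tendsto (fun ε : ℝ => ρ * (Z.card * ε ^ P.card)) (nhdsWithin 0 (Set.Ioi 0))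
      (nhds (ρ * (Z.card * 0 ^ P.card))) :=
    ((continuous_const.mul (continuous_const.mul (continuous_pow P.card))).tendsto 0).mono_left
      nhdsWithin_le_nhds
  have h1 := ge_of_tendsto hlim (Filter.eventually_of_mem self_mem_nhdsWithin key)
  rw [zero_pow hPpos.ne', mul_zero, mul_zero] at h1
  have : (0 : ℝ) < k * c := mul_pos (by exact_mod_cast hk0) hcpos
  linarith

/-- The spectral radius of a tensor that acts as the link sums of a uniform family. -/
theorem IsPerron.spectralRadius_eq (hk : 2 ≤ k) (hE : ∀ e ∈ E, e.card = k)
    (h : IsPerron E k ρ x) (T : HyperTensor k V)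
    (hT : ∀ (z : V → ℂ) (i : V), ∑ t : Fin (k - 1) → V, (T i t : ℂ) * ∏ j, z (t j) =
      linkSum E z i) : T.spectralRadius = ρ := by
  refine IsGreatest.csSup_eq ⟨⟨(ρ : ℂ), ⟨fun v => (x v : ℂ), ?_, fun i => ?_⟩, ?_⟩, ?_⟩
  · intro h0
    refine h.ne_zero (funext fun v => ?_)
    simpa using congrFun h0 v
  · refine (hT (fun v => (x v : ℂ)) i).trans ?_
    have := h.linkSum_eq hk i
    have h2 : linkSum E (fun v => (x v : ℂ)) i = ((linkSum E x i : ℝ) : ℂ) := by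
      simp [linkSum]
    rw [h2, this]
    push_cast
    rfl
  · rw [Complex.norm_real, Real.norm_of_nonneg h.value_nonneg]
  · rintro r ⟨lam, ⟨z, hz, heq⟩, rfl⟩
    have hn : ∀ v, 0 ≤ ‖z v‖ := fun v => norm_nonneg _
    have hz' : (fun v => ‖z v‖) ≠ 0 := by
      obtain ⟨v, hv⟩ := Function.ne_iff.1 hz
      exact Function.ne_iff.2 ⟨v, norm_ne_zero_iff.2 hv⟩
    have hpos := sum_pow_pos (k := k) hn hz'
    refine le_of_mul_le_mul_right ?_ hpos
    refine le_trans ?_ (h.bound _ hn)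
    -- The vector of moduli is the test vector: the eigenvalue equation is multiplied by `‖z i‖`,
    -- estimated by the triangle inequality and summed over `i`.
    rw [← sum_mul_linkSum hE, Finset.mul_sum]
    refine Finset.sum_le_sum fun i _ => ?_
    have h1 : ‖linkSum E z i‖ ≤ linkSum E (fun v => ‖z v‖) i := by
      refine (norm_sum_le _ _).trans (Finset.sum_le_sum fun e _ => ?_)
      rw [norm_prod]
    rw [← hT, heq, norm_mul, norm_pow] at h1
    calc ‖lam‖ * ‖z i‖ ^ k = ‖z i‖ * (‖lam‖ * ‖z i‖ ^ (k - 1)) := by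
          rw [mul_left_comm, ← pow_succ']; congr 2; omega
      _ ≤ _ := mul_le_mul_of_nonneg_left h1 (hn i)

end Perron

end EdgeFamily

/-! ### Set families and the adjacency tensor -/

namespace EdgeFamily

/-- Linear bicyclic `k`-uniform hypergraphs with `m` edges, for families of finite sets. -/
structure IsLinearBicyclic {V : Type*} [Fintype V] (E : Finset (Finset V)) (k m : ℕ) : Prop where
  nonempty : Nonempty V
  uniform : ∀ e ∈ E, e.card = k
  linear : ∀ e ∈ E, ∀ f ∈ E, e ≠ f → ∀ a ∈ e, a ∈ f → ∀ b ∈ e, b ∈ f → a = b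
  connected : ∀ a b, Relation.ReflTransGen (Linked E) a b
  card_edges : E.card = m
  -- This is `m (k - 1) - n + l = 2` with `l = 1`, written without subtracting `n`.
  card_vertices : Fintype.card V + 1 = m * (k - 1)

theorem card_filter_image_eq {V : Type*} [Fintype V] [DecidableEq V] {n : ℕ} (s : Finset V)
    (hs : s.card = n) :
    (Finset.univ.filter fun t : Fin n → V => Finset.univ.image t = s).card = n.factorial := by
  have h1 : (Finset.univ.filter fun t : Fin n → V => Finset.univ.image t = s) =
      Finset.univ.image fun (σ : Fin n ≃ s) (j : Fin n) => (σ j : V) := by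
    ext t
    simp only [Finset.mem_filter, Finset.mem_univ, true_and, Finset.mem_image]
    constructor
    · intro ht
      have hmem : ∀ j, t j ∈ s := fun j => ht ▸ Finset.mem_image_of_mem t (Finset.mem_univ j)
      have hsurj : Function.Surjective fun j => (⟨t j, hmem j⟩ : s) := by
        rintro ⟨v, hv⟩
        rw [← ht] at hv
        obtain ⟨j, -, hj⟩ := Finset.mem_image.1 hv
        exact ⟨j, Subtype.ext hj⟩
      have hbij := (Fintype.bijective_iff_surjective_and_card _).2 ⟨hsurj, by simp [hs]⟩
      exact ⟨Equiv.ofBijective _ hbij, rfl⟩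
    · rintro ⟨σ, rfl⟩
      ext v
      simp only [Finset.mem_image, Finset.mem_univ, true_and]
      constructor
      · rintro ⟨j, rfl⟩; exact (σ j).2
      · intro hv; exact ⟨σ.symm ⟨v, hv⟩, by simp⟩
  rw [h1, Finset.card_image_of_injective, Finset.card_univ,
    Fintype.card_equiv (Finset.equivFinOfCardEq hs).symm, Fintype.card_fin]
  intro σ τ h
  ext j
  exact congrFun h j

/-- Each edge through `i` comes from `(k - 1)!` index tuples, the enumerations of its other
vertices, which cancels the factor `1 / (k - 1)!`. -/
theorem sum_tensor_eq_linkSum {V R : Type*} [Fintype V] [DecidableEq V] [Field R] [CharZero R]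
    {E : Finset (Finset V)} {k : ℕ} (hk : 1 ≤ k) (hE : ∀ e ∈ E, e.card = k) (z : V → R) (i : V) :
    ∑ t : Fin (k - 1) → V, (if insert i (Finset.univ.image t) ∈ E then
      1 / ((k - 1).factorial : R) else 0) * ∏ j, z (t j) = linkSum E z i := by
  have h1 : ∀ t : Fin (k - 1) → V, (if insert i (Finset.univ.image t) ∈ E then
      1 / ((k - 1).factorial : R) else 0) * ∏ j, z (t j) =
      ∑ e ∈ E with i ∈ e, if Finset.univ.image t = e.erase i then
        1 / ((k - 1).factorial : R) * ∏ v ∈ e.erase i, z v else 0 := by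
    intro t
    have hcard : (Finset.univ.image t).card ≤ k - 1 := by
      simpa using Finset.card_image_le (s := Finset.univ) (f := t)
    by_cases h : insert i (Finset.univ.image t) ∈ E
    · have hi : i ∉ Finset.univ.image t := by
        intro hi
        have := hE _ h
        rw [Finset.insert_eq_of_mem hi] at this
        omega
      have hinj : Function.Injective t := by
        have hc := hE _ h
        rw [Finset.card_insert_of_notMem hi] at hc
        refine Set.injOn_univ.1 ?_
        rw [← Finset.coe_univ, ← Finset.card_image_iff, Finset.card_univ, Fintype.card_fin]
        omega
      rw [if_pos h, Finset.sum_eq_single (insert i (Finset.univ.image t)),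
        Finset.erase_insert hi, if_pos rfl, Finset.prod_image hinj.injOn]
      · intro e he hne
        rw [if_neg]
        intro heq
        exact hne (by rw [heq, Finset.insert_erase (Finset.mem_filter.1 he).2])
      · intro hn
        exact absurd (Finset.mem_filter.2 ⟨h, Finset.mem_insert_self i _⟩) hn
    · rw [if_neg h, zero_mul, Finset.sum_eq_zero]
      intro e he
      rw [if_neg]
      intro heq
      rw [heq, Finset.insert_erase (Finset.mem_filter.1 he).2] at h
      exact h (Finset.mem_filter.1 he).1
  simp_rw [h1]
  rw [Finset.sum_comm, linkSum]
  refine Finset.sum_congr rfl fun e he => ?_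
  rw [← Finset.sum_filter, Finset.sum_const, card_filter_image_eq (e.erase i) (by
    rw [Finset.card_erase_of_mem (Finset.mem_filter.1 he).2, hE e (Finset.mem_filter.1 he).1]),
    nsmul_eq_mul, ← mul_assoc, mul_one_div_cancel, one_mul]
  exact_mod_cast (k - 1).factorial_ne_zero

end EdgeFamily

/-! ### Translation between hypergraphs and set families -/

namespace Hypergraph

open EdgeFamily

open Classical in
/-- The edges of a finite hypergraph, as finite sets of vertices. -/
noncomputable def edgeFamily {α : Type*} (G : Hypergraph α) [Fintype G.vertexSet] :
    Finset (Finset G.vertexSet) :=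
  Finset.univ.filter fun s => Subtype.val '' (s : Set G.vertexSet) ∈ G.edgeSet

theorem image_val_injective {α : Type*} {G : Hypergraph α} :
    Function.Injective fun s : Finset G.vertexSet => Subtype.val '' (s : Set G.vertexSet) :=
  (Set.image_injective.2 Subtype.val_injective).comp Finset.coe_injective

theorem IsConnected.numComponents_eq_one {α : Type*} {G : Hypergraph α} (h : G.IsConnected) :
    G.numComponents = 1 := by
  have : Nonempty (Quotient G.walkSetoid) := ⟨Quotient.mk _ ⟨_, h.1.some_mem⟩⟩
  have : Subsingleton (Quotient G.walkSetoid) := ⟨by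
    intro a b
    induction a using Quotient.ind with | _ a => ?_
    induction b using Quotient.ind with | _ b => ?_
    exact Quotient.sound (h.2 a a.2 b b.2)⟩
  exact Nat.card_of_subsingleton (Classical.arbitrary _)

section

variable {α : Type*} {G : Hypergraph α} [Fintype G.vertexSet]

theorem mem_edgeFamily {s : Finset G.vertexSet} :
    s ∈ G.edgeFamily ↔ Subtype.val '' (s : Set G.vertexSet) ∈ G.edgeSet := by
  simp [edgeFamily]

theorem image_edgeFamily :
    (fun s : Finset G.vertexSet => Subtype.val '' (s : Set G.vertexSet)) '' G.edgeFamily =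
      G.edgeSet := by
  classical
  ext e
  constructor
  · rintro ⟨s, hs, rfl⟩
    exact mem_edgeFamily.1 hs
  · intro he
    have h1 : Subtype.val '' ((Subtype.val ⁻¹' e : Set G.vertexSet).toFinset : Set G.vertexSet) =
        e := by
      rw [Set.coe_toFinset, Subtype.image_preimage_coe]
      exact Set.inter_eq_right.2 (subset_vertexSet_of_mem_edgeSet he)
    exact ⟨_, mem_edgeFamily.2 (h1.symm ▸ he), h1⟩

theorem linked_edgeFamily {a b : G.vertexSet} : Linked G.edgeFamily a b ↔ G.Adj a b := by
  constructor
  · rintro ⟨e, he, ha, hb⟩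
    exact ⟨_, mem_edgeFamily.1 he, ⟨a, ha, rfl⟩, ⟨b, hb, rfl⟩⟩
  · rintro ⟨e, he, ha, hb⟩
    rw [← image_edgeFamily] at he
    obtain ⟨s, hs, rfl⟩ := he
    exact ⟨s, hs, by simpa using ha, by simpa using hb⟩

theorem reflTransGen_linked_iff {a b : G.vertexSet} :
    Relation.ReflTransGen (Linked G.edgeFamily) a b ↔ Relation.ReflTransGen G.Adj a b := by
  constructor
  · exact fun h => Relation.ReflTransGen.lift Subtype.val (fun _ _ => linked_edgeFamily.1) _ _ h
  · have : ∀ c : α, Relation.ReflTransGen G.Adj a c → ∀ hc : c ∈ G.vertexSet,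
        Relation.ReflTransGen (Linked G.edgeFamily) a ⟨c, hc⟩ := by
      intro c h
      induction h with
      | refl => exact fun _ => .refl
      | tail _ hs ih =>
        intro hc
        obtain ⟨e, he, hb, hc'⟩ := hs
        exact (ih (subset_vertexSet_of_mem_edgeSet he hb)).tail
          (linked_edgeFamily.2 ⟨e, he, hb, hc'⟩)
    exact fun h => this b h b.2

theorem ncard_edgeSet : G.edgeSet.ncard = G.edgeFamily.card := by
  rw [← image_edgeFamily, Set.ncard_image_of_injective _ image_val_injective,
    Set.ncard_coe_finset]

theorem isUniform_iff {k : ℕ} : G.IsUniform k ↔ ∀ e ∈ G.edgeFamily, e.card = k := by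
  have h : ∀ s : Finset G.vertexSet, (Subtype.val '' (s : Set G.vertexSet)).ncard = s.card :=
    fun s => by rw [Set.ncard_image_of_injective _ Subtype.val_injective, Set.ncard_coe_finset]
  rw [IsUniform, ← image_edgeFamily, Set.forall_mem_image]
  simp [h]

theorem isLinear_iff : G.IsLinear ↔ ∀ e ∈ G.edgeFamily, ∀ f ∈ G.edgeFamily, e ≠ f →
    ∀ a ∈ e, a ∈ f → ∀ b ∈ e, b ∈ f → a = b := by
  rw [IsLinear, ← image_edgeFamily]
  simp only [Set.forall_mem_image, ne_eq, image_val_injective.eq_iff]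
  refine forall₂_congr fun e _ => forall₂_congr fun f _ => imp_congr_right fun _ => ?_
  rw [← Set.image_inter Subtype.val_injective]
  constructor
  · intro h a ha ha' b hb hb'
    exact Subtype.ext (h ⟨a, ⟨ha, ha'⟩, rfl⟩ ⟨b, ⟨hb, hb'⟩, rfl⟩)
  · rintro h _ ⟨a, ha, rfl⟩ _ ⟨b, hb, rfl⟩
    rw [h a ha.1 ha.2 b hb.1 hb.2]

theorem isLinearBicyclic_iff {k m : ℕ} (hk : 1 ≤ k) :
    G.IsLinearBicyclic k m ↔ EdgeFamily.IsLinearBicyclic G.edgeFamily k m := by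
  have hconn : G.IsConnected ↔ Nonempty G.vertexSet ∧
      ∀ a b, Relation.ReflTransGen (Linked G.edgeFamily) a b := by
    simp_rw [reflTransGen_linked_iff, IsConnected, Set.nonempty_coe_sort, Subtype.forall]
  have hcyc : G.numComponents = 1 → G.edgeFamily.card = m →
      (G.cyclomaticNumber k = 2 ↔ Fintype.card G.vertexSet + 1 = m * (k - 1)) := by
    intro h1 h2
    obtain ⟨j, rfl⟩ : ∃ j, k = j + 1 := ⟨k - 1, by omega⟩
    rw [cyclomaticNumber, h1, ncard_edgeSet, h2, ← Nat.card_coe_set_eq, Nat.card_eq_fintype_card]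
    push_cast
    zify
    simp only [add_sub_cancel_right]
    constructor <;> intro h <;> linarith
  constructor
  · intro h
    have hc := hconn.1 h.bicyclic.1
    have hE := ncard_edgeSet (G := G) ▸ h.card_edges
    exact ⟨hc.1, isUniform_iff.1 h.uniform, isLinear_iff.1 h.linear, hc.2, hE,
      (hcyc h.bicyclic.1.numComponents_eq_one hE).1 h.bicyclic.2⟩
  · intro h
    have hc := hconn.2 ⟨h.nonempty, h.connected⟩
    exact ⟨Set.toFinite _, isUniform_iff.2 h.uniform, isLinear_iff.2 h.linear,
      ⟨hc, (hcyc hc.numComponents_eq_one h.card_edges).2 h.card_vertices⟩,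
      ncard_edgeSet.trans h.card_edges⟩

theorem spectralRadius_eq {k : ℕ} (hk : 2 ≤ k) (hE : ∀ e ∈ G.edgeFamily, e.card = k) {ρ : ℝ}
    {x : G.vertexSet → ℝ} (h : IsPerron G.edgeFamily k ρ x) : G.spectralRadius k = ρ := by
  classical
  rw [spectralRadius, Subsingleton.elim (Fintype.ofFinite G.vertexSet) ‹_›]
  refine h.spectralRadius_eq hk hE _ fun z i => ?_
  rw [← sum_tensor_eq_linkSum (by omega) hE]
  refine Finset.sum_congr rfl fun t _ => ?_
  have h1 : insert (i : α) (Set.range fun j => (t j : α)) =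
      Subtype.val '' ((insert i (Finset.univ.image t) : Finset G.vertexSet) :
        Set G.vertexSet) := by
    ext a
    simp [eq_comm]
  rw [adjTensor, h1]
  simp only [← mem_edgeFamily]
  split_ifs <;> simp

end

/-- The hypergraph on the vertices of `G` with the edges of the family `E`. -/
def withFamily {α : Type*} (G : Hypergraph α) (E : Finset (Finset G.vertexSet)) :
    Hypergraph α where
  vertexSet := G.vertexSet
  edgeSet := (fun s : Finset G.vertexSet => Subtype.val '' (s : Set G.vertexSet)) '' E
  subset_vertexSet_of_mem_edgeSet' := by
    rintro _ ⟨s, -, rfl⟩ _ ⟨a, -, rfl⟩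
    exact a.2

instance {α : Type*} (G : Hypergraph α) [h : Fintype G.vertexSet]
    (E : Finset (Finset G.vertexSet)) : Fintype (G.withFamily E).vertexSet := h

theorem edgeFamily_withFamily {α : Type*} (G : Hypergraph α) [Fintype G.vertexSet]
    (E : Finset (Finset G.vertexSet)) : (G.withFamily E).edgeFamily = E := by
  ext s
  rw [mem_edgeFamily]
  exact (image_val_injective (G := G)).mem_set_image

/-- A maximizing hypergraph has maximal value among the families on its vertex set. -/
theorem IsMaximizingLinearBicyclic.value_le {α : Type*} {G : Hypergraph α} [Fintype G.vertexSet]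
    {k m : ℕ} (hk : 2 ≤ k) (hG : G.IsMaximizingLinearBicyclic k m)
    {E : Finset (Finset G.vertexSet)} (hE : EdgeFamily.IsLinearBicyclic E k m) {ρ ρ' : ℝ}
    {x y : G.vertexSet → ℝ} (hx : IsPerron G.edgeFamily k ρ x) (hy : IsPerron E k ρ' y) :
    ρ' ≤ ρ := by
  have h1 := ((isLinearBicyclic_iff (by omega)).1 hG.1).uniform
  have h2 : EdgeFamily.IsLinearBicyclic (G.withFamily E).edgeFamily k m := by
    rw [edgeFamily_withFamily]; exact hE
  have h3 : IsPerron (G.withFamily E).edgeFamily k ρ' y := by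
    rw [edgeFamily_withFamily]; exact hy
  have h4 := hG.2 α (G.withFamily E) ((isLinearBicyclic_iff (by omega)).2 h2)
  rwa [spectralRadius_eq hk h1 hx, spectralRadius_eq hk h2.uniform h3] at h4

end Hypergraph

/-! ### Moving an edge, and counting around a vertex of largest entry -/

namespace EdgeFamily

/-- The family obtained by replacing the vertex `v` of the edge `f` by `u`. -/
def moveEdge {V : Type*} [DecidableEq V] (E : Finset (Finset V)) (f : Finset V) (v u : V) :
    Finset (Finset V) :=
  insert (insert u (f.erase v)) (E.erase f)

theorem edgeSum_le_moveEdge {V : Type*} [DecidableEq V] {E : Finset (Finset V)} {f : Finset V}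
    {u v : V} {x : V → ℝ} (hx : ∀ v, 0 ≤ x v) (hf : f ∈ E) (hv : v ∈ f)
    (hu : u ∉ f) (hnot : insert u (f.erase v) ∉ E) (hvu : x v ≤ x u) :
    edgeSum E x ≤ edgeSum (moveEdge E f v u) x := by
  have hnot' : insert u (f.erase v) ∉ E.erase f := fun h => hnot (Finset.mem_of_mem_erase h)
  have : u ∉ f.erase v := fun h => hu (Finset.mem_of_mem_erase h)
  rw [edgeSum, edgeSum, moveEdge, Finset.sum_insert hnot', Finset.prod_insert this,
    ← Finset.add_sum_erase _ _ hf, ← Finset.mul_prod_erase f x hv]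
  have := Finset.prod_nonneg (s := f.erase v) fun w _ => hx w
  gcongr

/-- This gives strict growth of the radius even when `x v = x u`. -/
theorem linkSum_moveEdge_lt {V : Type*} [DecidableEq V] {E : Finset (Finset V)} {f : Finset V}
    {u v : V} {x : V → ℝ} (hx : ∀ v, 0 < x v) (hf : f ∈ E) (hv : v ∈ f)
    (hu : u ∉ f) : linkSum (moveEdge E f v u) x v < linkSum E x v := by
  have hne : v ∉ insert u (f.erase v) := by
    simp only [Finset.mem_insert, Finset.mem_erase, not_or]
    exact ⟨fun h => hu (h ▸ hv), by simp⟩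
  rw [linkSum, linkSum, moveEdge, Finset.filter_insert, if_neg hne,
    Finset.filter_erase]
  refine Finset.sum_lt_sum_of_subset (Finset.erase_subset _ _) (i := f)
    (Finset.mem_filter.2 ⟨hf, hv⟩) (Finset.notMem_erase _ _)
    (Finset.prod_pos fun w _ => hx w) fun e _ _ => Finset.prod_nonneg fun w _ => (hx w).le

theorem IsLinearBicyclic.exists_edge {V : Type*} [Fintype V] {E : Finset (Finset V)}
    {k m : ℕ} {u v : V} (h : IsLinearBicyclic E k m) (huv : v ≠ u) :
    ∃ e ∈ E, v ∈ e := by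
  rcases (h.connected v u).cases_head with h | ⟨_, ⟨e, he, hv, -⟩, -⟩
  · exact absurd h huv
  · exact ⟨e, he, hv⟩

section Move

variable {V : Type*} [Fintype V] [DecidableEq V] {E : Finset (Finset V)} {k m : ℕ}
  {f : Finset V} {u v : V}

theorem IsLinearBicyclic.moved_notMem (h : IsLinearBicyclic E k m) (hk : 2 ≤ k) (hf : f ∈ E)
    (hv : v ∈ f) (hdisj : ∀ g ∈ E, u ∈ g → ∀ a ∈ f, a ≠ v → a ∉ g) :
    insert u (f.erase v) ∉ E := by
  intro hmem
  have hc : (f.erase v).card = k - 1 := by rw [Finset.card_erase_of_mem hv, h.uniform f hf]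
  obtain ⟨a, ha⟩ : (f.erase v).Nonempty := Finset.card_pos.1 (by omega)
  exact hdisj _ hmem (Finset.mem_insert_self _ _) a (Finset.mem_of_mem_erase ha)
    (Finset.ne_of_mem_erase ha) (Finset.mem_insert_of_mem ha)

/-- Linearity: an edge through `u` meets the new edge in `u` alone by `hdisj`, and any other edge
meets it inside `f`. Connectedness: `v` reaches `u` without `f`, and the remaining vertices of `f`
reach `u` by the new edge. -/
theorem IsLinearBicyclic.moveEdge (h : IsLinearBicyclic E k m) (hk : 2 ≤ k) (hf : f ∈ E)
    (hv : v ∈ f) (hu : u ∉ f) (hdisj : ∀ g ∈ E, u ∈ g → ∀ a ∈ f, a ≠ v → a ∉ g)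
    (hreach : Relation.ReflTransGen (Linked (E.erase f)) v u) :
    IsLinearBicyclic (moveEdge E f v u) k m := by
  have hnot := h.moved_notMem hk hf hv hdisj
  have hnot' : insert u (f.erase v) ∉ E.erase f := fun h => hnot (Finset.mem_of_mem_erase h)
  have hlin : ∀ g ∈ E, g ≠ f → ∀ a ∈ insert u (f.erase v), a ∈ g →
      ∀ b ∈ insert u (f.erase v), b ∈ g → a = b := by
    intro g hg hgf a ha hag b hb hbg
    rw [Finset.mem_insert, Finset.mem_erase] at ha hb
    by_cases hug : u ∈ g
    · have key : ∀ c, c = u ∨ c ≠ v ∧ c ∈ f → c ∈ g → c = u := fun c hc hcg =>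
        hc.resolve_right fun hc => hdisj g hg hug c hc.2 hc.1 hcg
      rw [key a ha hag, key b hb hbg]
    · have key : ∀ c, c = u ∨ c ≠ v ∧ c ∈ f → c ∈ g → c ∈ f := fun c hc hcg =>
        (hc.resolve_left fun hc => hug (hc ▸ hcg)).2
      exact h.linear g hg f hf hgf a hag (key a ha hag) b hbg (key b hb hbg)
  refine ⟨h.nonempty, ?_, ?_, ?_, ?_, h.card_vertices⟩
  · intro e he
    rcases Finset.mem_insert.1 he with rfl | he
    · have : u ∉ f.erase v := fun h => hu (Finset.mem_of_mem_erase h)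
      rw [Finset.card_insert_of_notMem this, Finset.card_erase_of_mem hv, h.uniform f hf]
      omega
    · exact h.uniform e (Finset.mem_of_mem_erase he)
  · intro e he e' he' hne a ha ha' b hb hb'
    rcases Finset.mem_insert.1 he with rfl | he
    · rcases Finset.mem_insert.1 he' with rfl | he'
      · exact absurd rfl hne
      · exact hlin e' (Finset.mem_of_mem_erase he') (Finset.ne_of_mem_erase he') a ha ha' b hb hb'
    · rcases Finset.mem_insert.1 he' with rfl | he'
      · exact hlin e (Finset.mem_of_mem_erase he) (Finset.ne_of_mem_erase he) a ha' ha b hb' hb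
      · exact h.linear e (Finset.mem_of_mem_erase he) e' (Finset.mem_of_mem_erase he') hne
          a ha ha' b hb hb'
  · have hsub : ∀ a b, Linked (E.erase f) a b → Linked (EdgeFamily.moveEdge E f v u) a b := by
      rintro a b ⟨e, he, hab⟩
      exact ⟨e, Finset.mem_insert_of_mem he, hab⟩
    have hsymm : ∀ a b, Relation.ReflTransGen (Linked (EdgeFamily.moveEdge E f v u)) a b →
        Relation.ReflTransGen (Linked (EdgeFamily.moveEdge E f v u)) b a := by
      intro a b hab
      induction hab with
      | refl => exact .refl
      | tail _ hs ih =>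
        obtain ⟨e, he, ha, hb⟩ := hs
        exact (Relation.ReflTransGen.single ⟨e, he, hb, ha⟩).trans ih
    have hto : ∀ a ∈ f, Relation.ReflTransGen (Linked (EdgeFamily.moveEdge E f v u)) a u := by
      intro a ha
      by_cases hav : a = v
      · subst hav
        exact Relation.ReflTransGen.mono hsub _ _ hreach
      · exact .single ⟨_, Finset.mem_insert_self _ _, by simp [hav, ha], by simp⟩
    intro a b
    have hab := h.connected a b
    induction hab with
    | refl => exact .refl
    | tail _ hs ih =>
      obtain ⟨e, he, ha, hb⟩ := hs
      by_cases hef : e = f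
      · subst hef
        exact ih.trans ((hto _ ha).trans (hsymm _ _ (hto _ hb)))
      · exact ih.tail (hsub _ _ ⟨e, Finset.mem_erase.2 ⟨hef, he⟩, ha, hb⟩)
  · rw [EdgeFamily.moveEdge, Finset.card_insert_of_notMem hnot', Finset.card_erase_of_mem hf,
      h.card_edges]
    have := Finset.card_pos.2 ⟨f, hf⟩
    rw [h.card_edges] at this
    omega

/-- `E` has maximal value among the linear bicyclic families on its vertex set, and `x` is a
corresponding vector. -/
structure IsMaximal {V : Type*} [Fintype V] (E : Finset (Finset V)) (k m : ℕ) (ρ : ℝ)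
    (x : V → ℝ) : Prop where
  isLinearBicyclic : IsLinearBicyclic E k m
  isPerron : IsPerron E k ρ x
  value_le : ∀ (E' : Finset (Finset V)) (ρ' : ℝ) (y : V → ℝ), IsLinearBicyclic E' k m →
    IsPerron E' k ρ' y → ρ' ≤ ρ

variable {ρ : ℝ} {x : V → ℝ}

theorem IsMaximal.pos (h : IsMaximal E k m ρ x) (v : V) : 0 < x v :=
  h.isPerron.pos h.isLinearBicyclic.uniform h.isLinearBicyclic.connected v

/-- In a maximal family no edge can be moved towards a larger entry of the vector. -/
theorem IsMaximal.exists_obstruction (h : IsMaximal E k m ρ x) (hk : 2 ≤ k) (hf : f ∈ E)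
    (hv : v ∈ f) (hu : u ∉ f) (hvu : x v ≤ x u)
    (hreach : Relation.ReflTransGen (Linked (E.erase f)) v u) :
    ∃ g ∈ E, u ∈ g ∧ ∃ a ∈ f, a ≠ v ∧ a ∈ g := by
  by_contra hno
  push Not at hno
  have hE' := h.isLinearBicyclic.moveEdge hk hf hv hu hno hreach
  have hne := h.isLinearBicyclic.nonempty
  obtain ⟨ρ', y, hy⟩ := exists_isPerron (by omega) hE'.uniform
  have hnot := h.isLinearBicyclic.moved_notMem hk hf hv hno
  have h1 := h.isPerron.lt_of_edgeSum_le hk hy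
    (edgeSum_le_moveEdge h.isPerron.nonneg hf hv hu hnot hvu)
    (linkSum_moveEdge_lt h.pos hf hv hu).ne
  exact absurd (h.value_le _ _ _ hE' hy) (not_le.2 h1)

/-- On a walk to `u`, the part after the last use of `f` starts in `f` and avoids `f`. -/
theorem IsLinearBicyclic.exists_reach (h : IsLinearBicyclic E k m) (hk : 1 ≤ k) (hf : f ∈ E)
    (u : V) : ∃ v ∈ f, Relation.ReflTransGen (Linked (E.erase f)) v u := by
  have key : ∀ a, Relation.ReflTransGen (Linked E) a u →
      Relation.ReflTransGen (Linked (E.erase f)) a u ∨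
      ∃ v ∈ f, Relation.ReflTransGen (Linked (E.erase f)) v u := by
    intro a ha
    induction ha using Relation.ReflTransGen.head_induction_on with
    | refl => exact Or.inl .refl
    | head hs _ ih =>
      rcases ih with ih | ih
      · obtain ⟨e, he, ha, hc⟩ := hs
        by_cases hef : e = f
        · subst hef
          exact Or.inr ⟨_, hc, ih⟩
        · exact Or.inl (.head ⟨e, Finset.mem_erase.2 ⟨hef, he⟩, ha, hc⟩ ih)
      · exact Or.inr ih
  obtain ⟨a, ha⟩ : f.Nonempty := Finset.card_pos.1 (by rw [h.uniform f hf]; omega)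
  exact (key a (h.connected a u)).elim (fun h => ⟨a, ha, h⟩) id

/-- Every edge off the vertex `u` with the largest entry has two neighbours of `u`. -/
theorem IsMaximal.exists_two_linked (h : IsMaximal E k m ρ x) (hk : 2 ≤ k)
    (hmax : ∀ v, x v ≤ x u) (hf : f ∈ E) (hu : u ∉ f) :
    ∃ a ∈ f, ∃ b ∈ f, a ≠ b ∧ Linked E u a ∧ Linked E u b := by
  obtain ⟨v, hv, hreach⟩ := h.isLinearBicyclic.exists_reach (by omega) hf u
  obtain ⟨g, hg, hug, b, hb, -, hbg⟩ := h.exists_obstruction hk hf hv hu (hmax v) hreach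
  have hgf : g ≠ f := by rintro rfl; exact hu hug
  -- The first vertex `v` need not be a neighbour of `u`, but `b` is, and it reaches `u` along `g`.
  -- Moving `f` away from `b` yields a second neighbour.
  obtain ⟨g', hg', hug', a, ha, hab, hag'⟩ := h.exists_obstruction hk hf hb hu (hmax b)
    (.single ⟨g, Finset.mem_erase.2 ⟨hgf, hg⟩, hbg, hug⟩)
  exact ⟨a, ha, b, hb, hab, ⟨g', hg', hug', hag'⟩, ⟨g, hg, hug, hbg⟩⟩

open Classical in
/-- The number of vertices that are not linked to `u`, in terms of the edges off `u`. -/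
theorem IsLinearBicyclic.card_biUnion_not_linked (h : IsLinearBicyclic E k m) (u : V) :
    (({e ∈ E | u ∉ e} : Finset (Finset V)).biUnion fun f => {v ∈ f | ¬ Linked E u v}).card + 2 =
      ({e ∈ E | u ∉ e} : Finset (Finset V)).card * (k - 1) := by
  set D := ({e ∈ E | u ∈ e} : Finset (Finset V)) with hD
  set R := ({e ∈ E | u ∉ e} : Finset (Finset V)) with hR
  -- `W` is `u` with its neighbours. By linearity the edges through `u` are disjoint outside `u`,
  -- and every vertex outside `W` lies in an edge off `u`.
  set W := insert u (D.biUnion fun g => g.erase u) with hW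
  have hWcard : W.card = D.card * (k - 1) + 1 := by
    rw [hW, Finset.card_insert_of_notMem (by simp), Finset.card_biUnion, Finset.sum_const_nat]
    · intro g hg
      rw [hD, Finset.mem_filter] at hg
      rw [Finset.card_erase_of_mem hg.2, h.uniform g hg.1]
    · intro g hg g' hg' hne
      rw [Finset.mem_coe, Finset.mem_filter] at hg hg'
      refine Finset.disjoint_left.2 ?_
      intro a ha ha'
      rw [Finset.mem_erase] at ha ha'
      exact ha.1 (h.linear g hg.1 g' hg'.1 hne a ha.2 ha'.2 u hg.2 hg'.2)
  have hcompl : (R.biUnion fun f => {v ∈ f | ¬ Linked E u v}) = Wᶜ := by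
    ext v
    simp only [hW, hR, hD, Finset.mem_biUnion, Finset.mem_filter, Finset.mem_compl,
      Finset.mem_insert, Finset.mem_erase, not_or, not_exists, not_and]
    constructor
    · rintro ⟨f, ⟨-, huf⟩, hvf, hl⟩
      exact ⟨fun h => huf (h ▸ hvf), fun g hg _ hvg => hl ⟨g, hg.1, hg.2, hvg⟩⟩
    · rintro ⟨hvu, hv⟩
      have hl : ¬ Linked E u v := fun ⟨g, hg, hug, hvg⟩ => hv g ⟨hg, hug⟩ hvu hvg
      obtain ⟨e, he, hve⟩ := h.exists_edge hvu
      exact ⟨e, ⟨he, fun hue => hl ⟨e, he, hue, hve⟩⟩, hve, hl⟩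
  have hDR : D.card + R.card = m := by
    rw [← h.card_edges]; exact Finset.card_filter_add_card_filter_not _
  have h1 := Finset.card_compl_add_card W
  have h2 := h.card_vertices
  rw [← hDR, Nat.add_mul] at h2
  rw [hcompl]
  omega

open Classical in
theorem IsMaximal.card_filter_not_linked_le (h : IsMaximal E k m ρ x) (hk : 2 ≤ k)
    (hmax : ∀ v, x v ≤ x u) (hf : f ∈ E) (hu : u ∉ f) :
    ({v ∈ f | ¬ Linked E u v} : Finset V).card + 2 ≤ k := by
  obtain ⟨a, ha, b, hb, hab, hla, hlb⟩ := h.exists_two_linked hk hmax hf hu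
  have h1 : 1 < ({v ∈ f | Linked E u v} : Finset V).card :=
    Finset.one_lt_card.2 ⟨a, by simp [ha, hla], b, by simp [hb, hlb], hab⟩
  have h2 := Finset.card_filter_add_card_filter_not (s := f) fun v => Linked E u v
  rw [h.isLinearBicyclic.uniform f hf] at h2
  omega

theorem IsLinearBicyclic.existsUnique_edge (h : IsLinearBicyclic E k m) (huv : v ≠ u)
    (h1 : ∀ f ∈ E, u ∉ f → v ∈ f → ¬ Linked E u v)
    (h2 : ∀ f ∈ E, ∀ f' ∈ E, u ∉ f → u ∉ f' → v ∈ f → v ∈ f' → ¬ Linked E u v → f = f') :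
    ∃! e, e ∈ E ∧ v ∈ e := by
  obtain ⟨e, he, hve⟩ := h.exists_edge huv
  refine ⟨e, ⟨he, hve⟩, ?_⟩
  rintro e' ⟨he', hve'⟩
  by_cases hu : u ∈ e <;> by_cases hu' : u ∈ e'
  · by_contra hne
    exact huv (h.linear e' he' e he hne v hve' hve u hu' hu)
  · exact absurd ⟨e, he, hu, hve⟩ (h1 e' he' hu' hve')
  · exact absurd ⟨e', he', hu', hve'⟩ (h1 e he hu hve)
  · exact h2 e' he' e he hu' hu hve' hve (h1 e he hu hve)

end Move

/-! ### Classification of the maximal families -/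

/-- The vertices `c i` and the edges `g j` have the incidences `inc`, the other edges contain
`c i₀` and no other `c i`, and every other vertex lies in exactly one edge. -/
structure IsStarSkeleton {V I J : Type*} (E : Finset (Finset V)) (c : I → V) (g : J → Finset V)
    (inc : I → J → Prop) (i₀ : I) : Prop where
  injective_vertex : Function.Injective c
  injective_edge : Function.Injective g
  mem_family : ∀ j, g j ∈ E
  mem_iff : ∀ i j, c i ∈ g j ↔ inc i j
  rest : ∀ e ∈ E, (∀ j, g j ≠ e) → ∀ i, c i ∈ e ↔ i = i₀
  existsUnique : ∀ v, (∀ i, c i ≠ v) → ∃! e, e ∈ E ∧ v ∈ e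

/-- The incidences of `G₅`: the vertex `none` and the edge `none` are opposite to each other. -/
def incG5 : Option (Fin 3) → Option (Fin 3) → Prop
  | none, none => False
  | none, some _ => True
  | some _, none => True
  | some i, some j => i = j

/-- The edges of `K₄` minus an edge. -/
def diamondEdge : Fin 5 → Sym2 (Fin 4) := ![s(0, 1), s(0, 2), s(0, 3), s(1, 2), s(1, 3)]

/-- The incidences of `K₄` minus an edge. -/
def incDiamond (i : Fin 4) (j : Fin 5) : Prop := i ∈ diamondEdge j

section Classification

variable {V : Type*} [Fintype V] [DecidableEq V] {E : Finset (Finset V)} {k m : ℕ}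
  {f f' : Finset V} {u a b d p q : V} {ρ : ℝ} {x : V → ℝ}

-- The three neighbours of `u` in `f` are joined to `u` by distinct edges, since an edge containing
-- two of them would share both with `f`.
open Classical in
theorem IsLinearBicyclic.exists_isStarSkeleton_of_card_eq_three (h : IsLinearBicyclic E k m)
    (hf : f ∈ E) (hu : u ∉ f) (honly : ∀ e ∈ E, e ≠ f → u ∈ e)
    (hcard : ({v ∈ f | Linked E u v} : Finset V).card = 3) :
    ∃ c g, IsStarSkeleton E c g incG5 none := by
  set S := ({v ∈ f | Linked E u v} : Finset V) with hS
  set σ := (Finset.equivFinOfCardEq hcard).symm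
  have ha : ∀ i, (σ i : V) ∈ f ∧ Linked E u (σ i) := fun i => Finset.mem_filter.1 (σ i).2
  choose b hbE hub hab using fun i => (ha i).2
  have hbf : ∀ i, b i ≠ f := fun i h => hu (h ▸ hub i)
  have hainj : ∀ i j, (σ i : V) = σ j → i = j := fun i j hij => σ.injective (Subtype.ext hij)
  have hmem : ∀ i j, (σ i : V) ∈ b j → i = j := fun i j hij =>
    hainj i j (h.linear _ (hbE j) f hf (hbf j) _ hij (ha i).1 _ (hab j) (ha j).1)
  have hau : ∀ i, (σ i : V) ≠ u := fun i h => hu (h ▸ (ha i).1)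
  refine ⟨fun o => o.elim u fun i => σ i, fun o => o.elim f b, ⟨?_, ?_, ?_, ?_, ?_, ?_⟩⟩
  · rintro (_ | i) (_ | j) hij
    · rfl
    · exact absurd hij.symm (hau j)
    · exact absurd hij (hau i)
    · exact congrArg some (hainj i j hij)
  · rintro (_ | i) (_ | j) hij
    · rfl
    · exact absurd hij.symm (hbf j)
    · exact absurd hij (hbf i)
    · refine congrArg some (hmem i j ?_)
      have hij' : b i = b j := hij
      exact hij' ▸ hab i
  · rintro (_ | i)
    · exact hf
    · exact hbE i
  · rintro (_ | i) (_ | j)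
    · simpa [incG5] using hu
    · simpa [incG5] using hub j
    · simpa [incG5] using (ha i).1
    · simp only [incG5, Option.elim_some]
      exact ⟨hmem i j, fun hij => hij ▸ hab i⟩
  · intro e he hne i
    have hue := honly e he (hne none).symm
    rcases i with _ | i
    · simpa using hue
    · simp only [Option.elim_some, reduceCtorEq, iff_false]
      intro hie
      exact hau i (h.linear _ (hbE i) e he (hne (some i)) _ (hab i) hie u (hub i) hue)
  · intro v hv
    have hvu : v ≠ u := (hv none).symm
    refine h.existsUnique_edge hvu ?_ ?_
    · intro f' hf' huf' hvf' hl
      have hff : f' = f := by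
        by_contra hne; exact huf' (honly f' hf' hne)
      subst hff
      have hvS : v ∈ S := Finset.mem_filter.2 ⟨hvf', hl⟩
      refine hv (some (σ.symm ⟨v, hvS⟩)) ?_
      simp
    · intro f₁ hf₁ f₂ hf₂ hu₁ hu₂ _ _ _
      rw [show f₁ = f by by_contra hne; exact hu₁ (honly f₁ hf₁ hne),
        show f₂ = f by by_contra hne; exact hu₂ (honly f₂ hf₂ hne)]

/-- Two edges off `u` with a common neighbour of `u`. -/
theorem IsLinearBicyclic.exists_isStarSkeleton_of_shared (h : IsLinearBicyclic E k m)
    (hf : f ∈ E) (hf' : f' ∈ E) (hne : f ≠ f') (hu : u ∉ f) (hu' : u ∉ f')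
    (honly : ∀ e ∈ E, e ≠ f → e ≠ f' → u ∈ e) (haf : a ∈ f) (haf' : a ∈ f') (hbf : b ∈ f)
    (hdf' : d ∈ f') (hab : a ≠ b) (had : a ≠ d) (hla : Linked E u a) (hlb : Linked E u b)
    (hld : Linked E u d) (hS : ∀ v ∈ f, Linked E u v → v = a ∨ v = b)
    (hS' : ∀ v ∈ f', Linked E u v → v = a ∨ v = d) :
    (∃ c g, IsStarSkeleton E c g incG5 (some 0)) ∨
    (∃ c g, IsStarSkeleton E c g incDiamond 0) := by
  obtain ⟨g, hg, hug, hag⟩ := hla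
  obtain ⟨g₁, hg₁, hug₁, hbg₁⟩ := hlb
  obtain ⟨g₂, hg₂, hug₂, hdg₂⟩ := hld
  -- These inequalities and non-incidences are what `assumption` looks up in the case checks below.
  have au : a ≠ u := by rintro rfl; exact hu haf
  have bu : b ≠ u := by rintro rfl; exact hu hbf
  have du : d ≠ u := by rintro rfl; exact hu' hdf'
  have gf : g ≠ f := by rintro rfl; exact hu hug
  have gf' : g ≠ f' := by rintro rfl; exact hu' hug
  have g₁f : g₁ ≠ f := by rintro rfl; exact hu hug₁
  have g₁f' : g₁ ≠ f' := by rintro rfl; exact hu' hug₁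
  have g₂f : g₂ ≠ f := by rintro rfl; exact hu hug₂
  have g₂f' : g₂ ≠ f' := by rintro rfl; exact hu' hug₂
  have bf' : b ∉ f' := fun hb => hab (h.linear f hf f' hf' hne a haf haf' b hbf hb)
  have df : d ∉ f := fun hd => had (h.linear f hf f' hf' hne a haf haf' d hd hdf')
  have bd : b ≠ d := by rintro rfl; exact bf' hdf'
  have ag₁ : a ∉ g₁ := fun ha => hab (h.linear g₁ hg₁ f hf g₁f a ha haf b hbg₁ hbf)
  have ag₂ : a ∉ g₂ := fun ha => had (h.linear g₂ hg₂ f' hf' g₂f' a ha haf' d hdg₂ hdf')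
  have bg : b ∉ g := fun hb => hab (h.linear g hg f hf gf a hag haf b hb hbf)
  have dg : d ∉ g := fun hd => had (h.linear g hg f' hf' gf' a hag haf' d hd hdf')
  have gg₁ : g ≠ g₁ := by rintro rfl; exact ag₁ hag
  have gg₂ : g ≠ g₂ := by rintro rfl; exact ag₂ hag
  have hstar : ∀ e ∈ E, u ∈ e → ∀ e' ∈ E, u ∈ e' → ∀ v, v ≠ u → v ∈ e → v ∈ e' → e = e' := by
    intro e he hue e' he' hue' v hvu hve hve'
    by_contra hne
    exact hvu (h.linear e he e' he' hne v hve hve' u hue hue')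
  have huniq : ∀ v, v ≠ u → v ≠ a → v ≠ b → v ≠ d → ∃! e, e ∈ E ∧ v ∈ e := by
    intro v hvu hva hvb hvd
    have hcase : ∀ e ∈ E, u ∉ e → e = f ∨ e = f' := by
      intro e he hue
      by_contra hc
      push Not at hc
      exact hue (honly e he hc.1 hc.2)
    refine h.existsUnique_edge hvu ?_ ?_
    · intro e he hue hve hl
      rcases hcase e he hue with rfl | rfl
      · exact (hS v hve hl).elim hva hvb
      · exact (hS' v hve hl).elim hva hvd
    · intro e he e' he' hue hue' hve hve' _
      by_contra hee
      refine hva ?_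
      rcases hcase e he hue with rfl | rfl <;> rcases hcase e' he' hue' with rfl | rfl
      · exact absurd rfl hee
      · exact h.linear _ he _ he' hee v hve hve' a haf haf'
      · exact h.linear _ he _ he' hee v hve hve' a haf' haf
      · exact absurd rfl hee
  by_cases h12 : g₁ = g₂
  · subst h12
    left
    -- Here `a` has the role of the degree-3 vertex of `G5`, with `g`, `f`, `f'` joining it to `u`,
    -- `b`, `d`; the edge `g₁` contains these three.
    refine ⟨fun o => o.elim a ![u, b, d], fun o => o.elim g₁ ![g, f, f'],
      ⟨?_, ?_, ?_, ?_, ?_, ?_⟩⟩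
    · rintro (_ | i) (_ | j) hij <;> (try fin_cases i) <;> (try fin_cases j) <;> first
        | rfl
        | exact absurd hij (by assumption)
        | exact absurd hij.symm (by assumption)
    · rintro (_ | i) (_ | j) hij <;> (try fin_cases i) <;> (try fin_cases j) <;> first
        | rfl
        | exact absurd hij (by assumption)
        | exact absurd hij.symm (by assumption)
    · rintro (_ | i)
      · exact hg₁
      · fin_cases i <;> assumption
    · rintro (_ | i) (_ | j) <;> (try fin_cases i) <;> (try fin_cases j) <;> first
        | exact iff_of_true (by assumption) (by simp [incG5])
        | exact iff_of_false (by assumption) (by simp [incG5])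
    · intro e he hno i
      have e1 : g₁ ≠ e := hno none
      have e2 : g ≠ e := hno (some 0)
      have hue := honly e he (hno (some 1)).symm (hno (some 2)).symm
      have hae : a ∉ e := fun ha => e2 (hstar g hg hug e he hue a au hag ha)
      have hbe : b ∉ e := fun hb => e1 (hstar g₁ hg₁ hug₁ e he hue b bu hbg₁ hb)
      have hde : d ∉ e := fun hd => e1 (hstar g₁ hg₁ hug₁ e he hue d du hdg₂ hd)
      rcases i with _ | i
      · simpa using hae
      · fin_cases i <;> first
        | exact iff_of_true (by assumption) (by simp)
        | exact iff_of_false (by assumption) (by simp)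
    · intro v hv
      exact huniq v (hv (some 0)).symm (hv none).symm (hv (some 1)).symm (hv (some 2)).symm
  · right
    have bg₂ : b ∉ g₂ := fun hb => h12 (hstar g₁ hg₁ hug₁ g₂ hg₂ hug₂ b bu hbg₁ hb)
    have dg₁ : d ∉ g₁ := fun hd => h12 (hstar g₁ hg₁ hug₁ g₂ hg₂ hug₂ d du hd hdg₂)
    -- The degree-3 vertices are `u` and `a`; the edges are in the order of `diamondEdge`.
    refine ⟨![u, a, b, d], ![g, g₁, g₂, f, f'], ⟨?_, ?_, ?_, ?_, ?_, ?_⟩⟩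
    · intro i j hij
      fin_cases i <;> fin_cases j <;> first
        | rfl
        | exact absurd hij (by assumption)
        | exact absurd hij.symm (by assumption)
    · intro i j hij
      fin_cases i <;> fin_cases j <;> first
        | rfl
        | exact absurd hij (by assumption)
        | exact absurd hij.symm (by assumption)
    · intro j
      fin_cases j <;> assumption
    · intro i j
      fin_cases i <;> fin_cases j <;> first
        | exact iff_of_true (by assumption) (by simp [incDiamond, diamondEdge])
        | exact iff_of_false (by assumption) (by simp [incDiamond, diamondEdge])
    · intro e he hno i
      have e0 : g ≠ e := hno 0
      have e1 : g₁ ≠ e := hno 1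
      have e2 : g₂ ≠ e := hno 2
      have hue := honly e he (hno 3).symm (hno 4).symm
      have hae : a ∉ e := fun ha => e0 (hstar g hg hug e he hue a au hag ha)
      have hbe : b ∉ e := fun hb => e1 (hstar g₁ hg₁ hug₁ e he hue b bu hbg₁ hb)
      have hde : d ∉ e := fun hd => e2 (hstar g₂ hg₂ hug₂ e he hue d du hdg₂ hd)
      fin_cases i <;> first
        | exact iff_of_true (by assumption) (by simp)
        | exact iff_of_false (by assumption) (by simp)
    · intro v hv
      exact huniq v (hv 0).symm (hv 1).symm (hv 2).symm (hv 3).symm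

/-- Two disjoint edges off `u` with two neighbours of `u` each do not occur. -/
theorem IsMaximal.false_of_disjoint (h : IsMaximal E k m ρ x) (hk : 2 ≤ k)
    (hf : f ∈ E) (hf' : f' ∈ E) (hu : u ∉ f) (hu' : u ∉ f')
    (honly : ∀ e ∈ E, e ≠ f → e ≠ f' → u ∈ e) (hdisj : Disjoint f f') (haf : a ∈ f)
    (hla : Linked E u a) (hpf : p ∈ f') (hqf : q ∈ f') (hpq : p ≠ q) (hlp : Linked E u p)
    (hlq : Linked E u q) (hS : ∀ v ∈ f', Linked E u v → v = p ∨ v = q) (hp : x p ≤ x a)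
    (hq : x q ≤ x a) : False := by
  have hlb := h.isLinearBicyclic
  have key : ∀ p q, p ∈ f' → q ∈ f' → p ≠ q → Linked E u p →
      (∀ v ∈ f', Linked E u v → v = p ∨ v = q) → x p ≤ x a →
      ∃ g ∈ E, u ∈ g ∧ a ∈ g ∧ q ∈ g := by
    intro p q hpf hqf hpq ⟨g', hg', hug', hpg'⟩ hS hp
    obtain ⟨g, hg, hug, hag⟩ := hla
    have haf' : a ∉ f' := Finset.disjoint_left.1 hdisj haf
    -- The edge `f'` is moved from `p` to `a`; the path from `p` to `a` runs through `u`. The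
    -- obstructing edge meets both `f` and `f'`, so it contains `u`, and its vertex in `f'` can only
    -- be `q`.
    obtain ⟨e, he, hae, v, hv, hvp, hve⟩ := h.exists_obstruction hk hf' hpf haf' hp
      ((Relation.ReflTransGen.single ⟨g', Finset.mem_erase.2
        ⟨by rintro rfl; exact hu' hug', hg'⟩, hpg', hug'⟩).tail
        ⟨g, Finset.mem_erase.2 ⟨by rintro rfl; exact hu' hug, hg⟩, hug, hag⟩)
    have hue : u ∈ e := by
      refine honly e he ?_ ?_
      · rintro rfl; exact Finset.disjoint_left.1 hdisj hve hv
      · rintro rfl; exact haf' hae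
    have hvq := (hS v hv ⟨e, he, hue, hve⟩).resolve_left hvp
    exact ⟨e, he, hue, hae, hvq ▸ hve⟩
  obtain ⟨g, hg, hug, hag, hqg⟩ := key p q hpf hqf hpq hlp hS hp
  obtain ⟨g', hg', hug', hag', hpg'⟩ := key q p hqf hpf hpq.symm hlq
    (fun v hv hl => (hS v hv hl).symm) hq
  have hau : a ≠ u := by rintro rfl; exact hu haf
  -- Exchanging `p` and `q` gives a second edge through `a` and `u`. By linearity it is the same
  -- edge, which then shares both `p` and `q` with `f'`.
  have hgg : g = g' := by
    by_contra hne
    exact hau (hlb.linear g hg g' hg' hne a hag hag' u hug hug')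
  subst hgg
  exact hpq (hlb.linear g hg f' hf' (by rintro rfl; exact hu' hug) p hpg' hpf q hqg hqf)

open Classical in
/-- The maximal families. -/
theorem IsMaximal.exists_isStarSkeleton (h : IsMaximal E k m ρ x) (hk : 3 ≤ k) :
    (∃ c g, IsStarSkeleton E c g incG5 none) ∨
    (∃ c g, IsStarSkeleton E c g incG5 (some 0)) ∨
    (∃ c g, IsStarSkeleton E c g incDiamond 0) := by
  have hlb := h.isLinearBicyclic
  have hne := hlb.nonempty
  obtain ⟨u, -, hmax⟩ := Finset.exists_max_image Finset.univ x Finset.univ_nonempty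
  replace hmax : ∀ v, x v ≤ x u := fun v => hmax v (Finset.mem_univ v)
  have hcount := hlb.card_biUnion_not_linked u
  set R := ({e ∈ E | u ∉ e} : Finset (Finset V)) with hR
  have hmemR : ∀ e, e ∈ R ↔ e ∈ E ∧ u ∉ e := fun e => Finset.mem_filter
  have hle : ∀ f ∈ R, ({v ∈ f | ¬ Linked E u v} : Finset V).card ≤ k - 2 := by
    intro f hf
    have := h.card_filter_not_linked_le (by omega) hmax ((hmemR f).1 hf).1 ((hmemR f).1 hf).2
    omega
  have hsplit : ∀ f ∈ R, ({v ∈ f | Linked E u v} : Finset V).card +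
      ({v ∈ f | ¬ Linked E u v} : Finset V).card = k := by
    intro f hf
    rw [Finset.card_filter_add_card_filter_not, hlb.uniform f ((hmemR f).1 hf).1]
  -- With `r = R.card`, the count gives `r * (k - 1) ≤ r * (k - 2) + 2`.
  have hR2 : R.card ≤ 2 := by
    have h1 := Finset.card_biUnion_le_card_mul R (fun f => {v ∈ f | ¬ Linked E u v}) _ hle
    obtain ⟨j, rfl⟩ : ∃ j, k = j + 2 := ⟨k - 2, by omega⟩
    have h2 : R.card * (j + 2 - 1) = R.card * (j + 2 - 2) + R.card := by
      rw [show j + 2 - 1 = (j + 2 - 2) + 1 by omega]; ring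
    omega
  have hR0 : R.card ≠ 0 := by
    intro h0
    rw [h0, zero_mul] at hcount
    omega
  obtain h1 | h2 : R.card = 1 ∨ R.card = 2 := by omega
  · obtain ⟨f, hf⟩ := Finset.card_eq_one.1 h1
    have hfR : f ∈ R := by simp [hf]
    have hfE := (hmemR f).1 hfR
    have h3 := hsplit f hfR
    rw [hf, Finset.singleton_biUnion, Finset.card_singleton] at hcount
    exact Or.inl <| hlb.exists_isStarSkeleton_of_card_eq_three hfE.1 hfE.2
      (fun e he hef => by
        by_contra hue
        have : e ∈ R := (hmemR e).2 ⟨he, hue⟩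
        rw [hf, Finset.mem_singleton] at this
        exact hef this) (by omega)
  · right
    obtain ⟨f, f', hff, hf⟩ := Finset.card_eq_two.1 h2
    have hfR : f ∈ R := by simp [hf]
    have hfR' : f' ∈ R := by simp [hf]
    have hfE := (hmemR f).1 hfR
    have hfE' := (hmemR f').1 hfR'
    have honly : ∀ e ∈ E, e ≠ f → e ≠ f' → u ∈ e := by
      intro e he hef hef'
      by_contra hue
      have : e ∈ R := (hmemR e).2 ⟨he, hue⟩
      rw [hf, Finset.mem_insert, Finset.mem_singleton] at this
      exact this.elim hef hef'
    rw [hf, Finset.card_pair hff, Finset.biUnion_insert, Finset.singleton_biUnion] at hcount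
    have hunion := Finset.card_union_add_card_inter ({v ∈ f | ¬ Linked E u v} : Finset V)
      ({v ∈ f' | ¬ Linked E u v} : Finset V)
    have hl := hle f hfR
    have hl' := hle f' hfR'
    have hs := hsplit f hfR
    have hs' := hsplit f' hfR'
    -- The union has `2 * (k - 1) - 2` elements, twice the bound `k - 2`, so the two sets are
    -- disjoint and both bounds are sharp.
    have hinter : ({v ∈ f | ¬ Linked E u v} : Finset V) ∩ {v ∈ f' | ¬ Linked E u v} = ∅ :=
      Finset.card_eq_zero.1 (by omega)
    have hc : ({v ∈ f | Linked E u v} : Finset V).card = 2 := by omega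
    have hc' : ({v ∈ f' | Linked E u v} : Finset V).card = 2 := by omega
    have hcommon : ∀ v ∈ f, v ∈ f' → Linked E u v := by
      intro v hv hv'
      by_contra hl
      have : v ∈ ({v ∈ f | ¬ Linked E u v} : Finset V) ∩ {v ∈ f' | ¬ Linked E u v} := by
        simp [hv, hv', hl]
      rw [hinter] at this
      simp at this
    have hpair : ∀ f, ({v ∈ f | Linked E u v} : Finset V).card = 2 → ∀ a ∈ f, Linked E u a →
        ∃ b ∈ f, a ≠ b ∧ Linked E u b ∧ ∀ v ∈ f, Linked E u v → v = a ∨ v = b := by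
      intro f hf a ha hla
      have ha' : a ∈ ({v ∈ f | Linked E u v} : Finset V) := by simp [ha, hla]
      obtain ⟨b, hb⟩ := Finset.card_eq_one.1
        ((Finset.card_erase_of_mem ha').trans (by rw [hf]))
      have hb' : b ∈ ({v ∈ f | Linked E u v} : Finset V).erase a := by simp [hb]
      rw [Finset.mem_erase, Finset.mem_filter] at hb'
      refine ⟨b, hb'.2.1, hb'.1.symm, hb'.2.2, fun v hv hl => ?_⟩
      by_contra hno
      push Not at hno
      have : v ∈ ({v ∈ f | Linked E u v} : Finset V).erase a := by simp [hno.1, hv, hl]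
      rw [hb, Finset.mem_singleton] at this
      exact hno.2 this
    by_cases hdisj : Disjoint f f'
    · exfalso
      obtain ⟨a, ha, hamax⟩ := Finset.exists_max_image {v ∈ f | Linked E u v} x
        (Finset.card_pos.1 (by omega))
      obtain ⟨p, hp, hpmax⟩ := Finset.exists_max_image {v ∈ f' | Linked E u v} x
        (Finset.card_pos.1 (by omega))
      rw [Finset.mem_filter] at ha hp
      obtain ⟨b, hb, hab, hlb', hS⟩ := hpair f hc a ha.1 ha.2
      obtain ⟨q, hq, hpq, hlq, hS'⟩ := hpair f' hc' p hp.1 hp.2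
      have hba := hamax b (by simp [hb, hlb'])
      have hqp := hpmax q (by simp [hq, hlq])
      rcases le_total (x p) (x a) with hle | hle
      · exact h.false_of_disjoint (by omega) hfE.1 hfE'.1 hfE.2 hfE'.2 honly hdisj ha.1 ha.2
          hp.1 hq hpq hp.2 hlq hS' hle (hqp.trans hle)
      · exact h.false_of_disjoint (by omega) hfE'.1 hfE.1 hfE'.2 hfE.2
          (fun e he h1 h2 => honly e he h2 h1) hdisj.symm hp.1 hp.2
          ha.1 hb hab ha.2 hlb' hS hle (hba.trans hle)
    · obtain ⟨a, haf, haf'⟩ := Finset.not_disjoint_iff.1 hdisj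
      have hla := hcommon a haf haf'
      obtain ⟨b, hb, hab, hlb', hS⟩ := hpair f hc a haf hla
      obtain ⟨d, hd, had, hld, hS'⟩ := hpair f' hc' a haf' hla
      exact hlb.exists_isStarSkeleton_of_shared hfE.1 hfE'.1 hff hfE.2 hfE'.2 honly haf haf' hb
        hd hab had hla hlb' hld hS hS'

end Classification

end EdgeFamily

/-! ### Skeletons determine uniform hypergraphs -/

namespace Hypergraph

open EdgeFamily

/-- The vertices `c i` and the edges `g j` have the incidences `inc`; these are all edges, and
every other vertex lies in exactly one edge. -/
structure IsSkeleton {α I J : Type*} (G : Hypergraph α) (c : I → α) (g : J → Set α)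
    (inc : I → J → Prop) : Prop where
  mem_vertexSet : ∀ i, c i ∈ G.vertexSet
  injective_vertex : Function.Injective c
  injective_edge : Function.Injective g
  range_eq : Set.range g = G.edgeSet
  mem_iff : ∀ i j, c i ∈ g j ↔ inc i j
  existsUnique : ∀ v ∈ G.vertexSet, (∀ i, c i ≠ v) → ∃! j, v ∈ g j

section Iso

variable {α β I J : Type*} {G : Hypergraph α} {H : Hypergraph β} {c : I → α} {g : J → Set α}
  {c' : I → β} {g' : J → Set β} {inc : I → J → Prop} {k : ℕ}

theorem IsSkeleton.mem_edgeSet (h : G.IsSkeleton c g inc) (j : J) : g j ∈ G.edgeSet :=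
  h.range_eq ▸ Set.mem_range_self j

/-- The number of degree-one vertices that an edge has outside the skeleton depends on `k` and `inc`
only, so these parts can be matched between two hypergraphs. -/
theorem IsSkeleton.ncard_diff_range (hk : k ≠ 0) (h : G.IsSkeleton c g inc)
    (hG : G.IsUniform k) (j : J) : (g j \ Set.range c).ncard + {i | inc i j}.ncard = k := by
  have h1 : g j ∩ Set.range c = c '' {i | inc i j} := by
    ext v
    constructor
    · rintro ⟨hv, i, rfl⟩
      exact ⟨i, (h.mem_iff i j).1 hv, rfl⟩
    · rintro ⟨i, hi, rfl⟩
      exact ⟨(h.mem_iff i j).2 hi, i, rfl⟩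
  rw [← hG _ (h.mem_edgeSet j), ← Set.ncard_image_of_injective _ h.injective_vertex, ← h1]
  -- `Set.ncard` is `0` on infinite sets, so `k ≠ 0` forces finiteness.
  have hfin : (g j).Finite := Set.finite_of_ncard_ne_zero (by
    rw [hG _ (h.mem_edgeSet j)]; exact hk)
  rw [add_comm]
  exact Set.ncard_inter_add_ncard_sdiff_eq_ncard (g j) (Set.range c) hfin

/-- The vertices of a hypergraph with a skeleton, sorted by the skeleton. -/
theorem IsSkeleton.exists_equiv (h : G.IsSkeleton c g inc) :
    ∃ φ : I ⊕ (Σ j, ↥(g j \ Set.range c)) ≃ G.vertexSet,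
      (∀ i, (φ (Sum.inl i) : α) = c i) ∧ ∀ p, (φ (Sum.inr p) : α) = p.2 := by
  set φ : I ⊕ (Σ j, ↥(g j \ Set.range c)) → G.vertexSet := Sum.elim
    (fun i => ⟨c i, h.mem_vertexSet i⟩)
    (fun p => ⟨p.2, subset_vertexSet_of_mem_edgeSet (h.mem_edgeSet p.1) p.2.2.1⟩) with hφ
  have hbij : Function.Bijective φ := by
    constructor
    · rintro (i | ⟨j, v, hv⟩) (i' | ⟨j', v', hv'⟩) heq
      · exact congrArg Sum.inl (h.injective_vertex (congrArg Subtype.val heq))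
      · exact absurd ⟨i, congrArg Subtype.val heq⟩ hv'.2
      · exact absurd ⟨i', (congrArg Subtype.val heq).symm⟩ hv.2
      · have hvv : v = v' := congrArg Subtype.val heq
        subst hvv
        have hu := h.existsUnique v (subset_vertexSet_of_mem_edgeSet (h.mem_edgeSet j) hv.1)
          fun i hi => hv.2 ⟨i, hi⟩
        have hj : j = j' := hu.unique hv.1 hv'.1
        subst hj
        rfl
    · rintro ⟨v, hv⟩
      by_cases hc : ∃ i, c i = v
      · obtain ⟨i, rfl⟩ := hc
        exact ⟨Sum.inl i, rfl⟩
      · obtain ⟨j, hj, -⟩ := h.existsUnique v hv fun i hi => hc ⟨i, hi⟩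
        exact ⟨Sum.inr ⟨j, v, hj, hc⟩, rfl⟩
  exact ⟨Equiv.ofBijective φ hbij, fun _ => rfl, fun _ => rfl⟩

/-- Uniform hypergraphs with the same skeleton are isomorphic. -/
theorem IsSkeleton.isIsomorphic (hk : k ≠ 0) (h : G.IsSkeleton c g inc)
    (h' : H.IsSkeleton c' g' inc) (hG : G.IsUniform k) (hH : H.IsUniform k) :
    G.IsIsomorphic H := by
  have hfin : ∀ j, (g j).Finite := fun j =>
    Set.finite_of_ncard_ne_zero (by rw [hG _ (h.mem_edgeSet j)]; exact hk)
  have hfin' : ∀ j, (g' j).Finite := fun j =>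
    Set.finite_of_ncard_ne_zero (by rw [hH _ (h'.mem_edgeSet j)]; exact hk)
  have hσ : ∀ j, Nonempty (↥(g j \ Set.range c) ≃ ↥(g' j \ Set.range c')) := by
    intro j
    have := (hfin j).sdiff (t := Set.range c) |>.to_subtype
    have := (hfin' j).sdiff (t := Set.range c') |>.to_subtype
    refine Finite.card_eq.1 ?_
    rw [Nat.card_coe_set_eq, Nat.card_coe_set_eq]
    have h1 := h.ncard_diff_range hk hG j
    have h2 := h'.ncard_diff_range hk hH j
    omega
  set σ := fun j => (hσ j).some
  obtain ⟨φ, hφl, hφr⟩ := h.exists_equiv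
  obtain ⟨ψ, hψl, hψr⟩ := h'.exists_equiv
  set τ : I ⊕ (Σ j, ↥(g j \ Set.range c)) ≃ I ⊕ (Σ j, ↥(g' j \ Set.range c')) :=
    (Equiv.refl I).sumCongr (Equiv.sigmaCongrRight σ) with hτ
  -- For a skeleton vertex membership is read off `inc`; any other vertex lies in the one edge that
  -- indexes it, on both sides.
  have hmem : ∀ (w : I ⊕ (Σ j, ↥(g j \ Set.range c))) (j : J),
      (φ w : α) ∈ g j ↔ (ψ (τ w) : β) ∈ g' j := by
    rintro (i | ⟨j', v⟩) j
    · rw [hφl, h.mem_iff]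
      change _ ↔ (ψ (Sum.inl i) : β) ∈ g' j
      rw [hψl, h'.mem_iff]
    · rw [hφr]
      change _ ↔ (ψ (Sum.inr ⟨j', σ j' v⟩) : β) ∈ g' j
      rw [hψr]
      have hu := h.existsUnique v
        (subset_vertexSet_of_mem_edgeSet (h.mem_edgeSet j') v.2.1) fun i hi => v.2.2 ⟨i, hi⟩
      have hu' := h'.existsUnique (σ j' v)
        (subset_vertexSet_of_mem_edgeSet (h'.mem_edgeSet j') (σ j' v).2.1)
        fun i hi => (σ j' v).2.2 ⟨i, hi⟩
      constructor
      · intro hv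
        have hj : j = j' := hu.unique hv v.2.1
        exact hj ▸ (σ j' v).2.1
      · intro hv
        have hj : j = j' := hu'.unique hv (σ j' v).2.1
        exact hj ▸ v.2.1
  set Φ : G.vertexSet ≃ H.vertexSet := (φ.symm.trans τ).trans ψ with hΦ
  have hΦmem : ∀ (v : G.vertexSet) (j : J), (v : α) ∈ g j ↔ (Φ v : β) ∈ g' j := by
    intro v j
    have := hmem (φ.symm v) j
    rwa [Equiv.apply_symm_apply] at this
  have himage : ∀ (s : Set G.vertexSet) (j : J),
      (fun x : G.vertexSet => (x : α)) '' s = g j ↔ (fun x : G.vertexSet => (Φ x : β)) '' s = g' j := by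
    intro s j
    have h1 : (fun x : G.vertexSet => (x : α)) '' s = g j ↔ ∀ v, v ∈ s ↔ (v : α) ∈ g j := by
      constructor
      · intro hs v
        rw [← hs]
        exact (Subtype.val_injective.mem_set_image).symm
      · intro hs
        ext a
        constructor
        · rintro ⟨v, hv, rfl⟩; exact (hs v).1 hv
        · intro ha
          have hav := subset_vertexSet_of_mem_edgeSet (h.mem_edgeSet j) ha
          exact ⟨⟨a, hav⟩, (hs _).2 ha, rfl⟩
    have h2 : (fun x : G.vertexSet => (Φ x : β)) '' s = g' j ↔ ∀ v, v ∈ s ↔ (Φ v : β) ∈ g' j := by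
      constructor
      · intro hs v
        rw [← hs]
        exact ((Subtype.val_injective.comp Φ.injective).mem_set_image).symm
      · intro hs
        ext a
        constructor
        · rintro ⟨v, hv, rfl⟩; exact (hs v).1 hv
        · intro ha
          have hav := subset_vertexSet_of_mem_edgeSet (h'.mem_edgeSet j) ha
          refine ⟨Φ.symm ⟨a, hav⟩, (hs _).2 ?_, ?_⟩ <;> simp [ha]
    rw [h1, h2]
    exact forall_congr' fun v => by rw [hΦmem v j]
  refine ⟨Φ, fun s => ?_⟩
  rw [← h.range_eq, ← h'.range_eq, Set.image_id']
  exact exists_congr fun j => by rw [eq_comm, himage s j, eq_comm]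

end Iso

/-- The skeleton of a family, completed by edges that meet it in the vertex `c i₀` only. -/
theorem _root_.EdgeFamily.IsStarSkeleton.exists_isSkeleton {α I J : Type*} [Fintype J] {G : Hypergraph α}
    [Fintype G.vertexSet] {c : I → G.vertexSet} {g : J → Finset G.vertexSet} {inc : I → J → Prop}
    {i₀ : I} (h : IsStarSkeleton G.edgeFamily c g inc i₀) {s : ℕ}
    (hcard : G.edgeFamily.card - Fintype.card J = s) :
    ∃ g' : J ⊕ Fin s → Set α, G.IsSkeleton (fun i => (c i : α)) g'
      fun i => Sum.elim (inc i) fun _ => i = i₀ := by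
  classical
  set D := G.edgeFamily \ Finset.univ.image g with hD
  have hDcard : D.card = s := by
    rw [hD, Finset.card_sdiff_of_subset, Finset.card_image_of_injective _ h.injective_edge,
      Finset.card_univ, hcard]
    intro e he
    obtain ⟨j, -, rfl⟩ := Finset.mem_image.1 he
    exact h.mem_family j
  set τ := (Finset.equivFinOfCardEq hDcard).symm
  have hτ : ∀ t, (τ t : Finset G.vertexSet) ∈ G.edgeFamily ∧
      ∀ j, g j ≠ (τ t : Finset G.vertexSet) := by
    intro t
    have := Finset.mem_sdiff.1 (τ t).2
    exact ⟨this.1, fun j hj => this.2 (hj ▸ Finset.mem_image_of_mem g (Finset.mem_univ j))⟩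
  set g₁ : J ⊕ Fin s → Finset G.vertexSet := Sum.elim g fun t => (τ t : Finset G.vertexSet)
    with hg₁
  have hinj : Function.Injective g₁ :=
    h.injective_edge.sumElim (Subtype.val_injective.comp τ.injective) fun j t => (hτ t).2 j
  have hrange : ∀ e, e ∈ G.edgeFamily ↔ ∃ p, g₁ p = e := by
    intro e
    constructor
    · intro he
      by_cases hj : ∃ j, g j = e
      · obtain ⟨j, rfl⟩ := hj
        exact ⟨Sum.inl j, rfl⟩
      · have heD : e ∈ D := by
          rw [hD, Finset.mem_sdiff, Finset.mem_image]
          exact ⟨he, fun ⟨j, _, hj'⟩ => hj ⟨j, hj'⟩⟩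
        exact ⟨Sum.inr (τ.symm ⟨e, heD⟩), by simp [hg₁]⟩
    · rintro ⟨j | t, rfl⟩
      · exact h.mem_family j
      · exact (hτ t).1
  have hval : ∀ (v : G.vertexSet) (e : Finset G.vertexSet),
      (v : α) ∈ Subtype.val '' (e : Set G.vertexSet) ↔ v ∈ e := fun v e => by
    simp
  refine ⟨fun p => Subtype.val '' (g₁ p : Set G.vertexSet), fun i => (c i).2,
    Subtype.val_injective.comp h.injective_vertex, image_val_injective.comp hinj, ?_, ?_, ?_⟩
  · rw [← image_edgeFamily]
    ext e
    constructor
    · rintro ⟨p, rfl⟩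
      exact ⟨g₁ p, (hrange _).2 ⟨p, rfl⟩, rfl⟩
    · rintro ⟨s, hs, rfl⟩
      obtain ⟨p, rfl⟩ := (hrange s).1 hs
      exact ⟨p, rfl⟩
  · rintro i (j | t)
    · rw [hval]; exact h.mem_iff i j
    · rw [hval]; exact h.rest _ (hτ t).1 (hτ t).2 i
  · intro v hv hc
    obtain ⟨e, ⟨he, hve⟩, huniq⟩ := h.existsUnique ⟨v, hv⟩ fun i hi => hc i (congrArg Subtype.val hi)
    obtain ⟨p, rfl⟩ := (hrange e).1 he
    refine ⟨p, (hval ⟨v, hv⟩ _).2 hve, fun q hq => ?_⟩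
    exact hinj (huniq _ ⟨(hrange _).2 ⟨q, rfl⟩, (hval ⟨v, hv⟩ _).1 hq⟩)

/-! ### Skeletons of coalescences and powers -/

section Coalescence

variable {α β I J J' : Type*} {G : Hypergraph α} {H : Hypergraph β} {k : ℕ}

theorem glue_injective (v : α) (u : β) : Function.Injective (glue v u) := by
  intro x y h
  unfold glue at h
  split_ifs at h with hx hy hy
  · rw [hx, hy]
  · exact congrArg Subtype.val (Sum.inr_injective h)

theorem glue_self (v : α) (u : β) : glue v u u = Sum.inl v := by simp [glue]

theorem inl_mem_image_glue {v a : α} {u : β} {s : Set β} :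
    Sum.inl a ∈ glue v u '' s ↔ u ∈ s ∧ a = v := by
  constructor
  · rintro ⟨x, hx, h⟩
    unfold glue at h
    split_ifs at h with hxu
    exact ⟨hxu ▸ hx, (Sum.inl_injective h).symm⟩
  · rintro ⟨hu, rfl⟩
    exact ⟨u, hu, glue_self a u⟩

theorem inr_mem_image_glue {v : α} {u : β} {s : Set β} {y : {y : β // y ≠ u}} :
    Sum.inr y ∈ glue v u '' s ↔ (y : β) ∈ s := by
  have hy : glue v u (y : β) = Sum.inr y := by simp [glue, y.2]
  rw [← hy, (glue_injective v u).mem_set_image]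

theorem IsUniform.coalescence {v : α} {u : β} (hG : G.IsUniform k) (hH : H.IsUniform k) :
    (coalescence G v H u).IsUniform k := by
  rintro _ (⟨e, he, rfl⟩ | ⟨e, he, rfl⟩)
  · rw [Set.ncard_image_of_injective _ Sum.inl_injective, hG e he]
  · rw [Set.ncard_image_of_injective _ (glue_injective v u), hH e he]

/-- Every edge of `H` contains `u` and every other vertex of `H` has degree one, so gluing adds
edges that meet the skeleton of `G` in `c i₀` only. -/
theorem IsSkeleton.coalescence {c : I → α} {g : J → Set α} {inc : I → J → Prop}
    {u : β} {g' : J' → Set β} (h : G.IsSkeleton c g inc)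
    (h' : H.IsSkeleton (fun _ : Unit => u) g' fun _ _ => True) (hk : 2 ≤ k) (hH : H.IsUniform k)
    (i₀ : I) : (coalescence G (c i₀) H u).IsSkeleton (fun i => Sum.inl (c i))
      (Sum.elim (fun j => Sum.inl '' g j) fun t => glue (c i₀) u '' g' t)
      fun i => Sum.elim (inc i) fun _ => i = i₀ := by
  have hu : ∀ t, u ∈ g' t := fun t => (h'.mem_iff () t).2 trivial
  refine ⟨fun i => Or.inl ⟨_, h.mem_vertexSet i, rfl⟩, Sum.inl_injective.comp h.injective_vertex,
    ?_, ?_, ?_, ?_⟩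
  · refine (Set.image_injective.2 Sum.inl_injective |>.comp h.injective_edge).sumElim
      (Set.image_injective.2 (glue_injective _ _) |>.comp h'.injective_edge) fun j t heq => ?_
    have hcard := hH _ (h'.mem_edgeSet t)
    -- A vertex other than `u` survives on the right side of the sum, which tells edges of `H` from
    -- edges of `G`.
    obtain ⟨y, hy, hyu⟩ := Set.exists_ne_of_one_lt_ncard (by omega : 1 < (g' t).ncard) u
    have : (Sum.inr ⟨y, hyu⟩ : α ⊕ {y : β // y ≠ u}) ∈ Sum.inl '' g j := by
      change Sum.inl '' g j = glue (c i₀) u '' g' t at heq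
      rw [heq]
      exact inr_mem_image_glue.2 hy
    simp at this
  · ext e
    constructor
    · rintro ⟨j | t, rfl⟩
      · exact Or.inl ⟨_, h.mem_edgeSet j, rfl⟩
      · exact Or.inr ⟨_, h'.mem_edgeSet t, rfl⟩
    · rintro (⟨s, hs, rfl⟩ | ⟨s, hs, rfl⟩)
      · rw [← h.range_eq] at hs
        obtain ⟨j, rfl⟩ := hs
        exact ⟨Sum.inl j, rfl⟩
      · rw [← h'.range_eq] at hs
        obtain ⟨t, rfl⟩ := hs
        exact ⟨Sum.inr t, rfl⟩
  · rintro i (j | t)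
    · exact (Sum.inl_injective.mem_set_image).trans (h.mem_iff i j)
    · exact inl_mem_image_glue.trans
        ⟨fun hi => h.injective_vertex hi.2, fun hi => ⟨hu t, congrArg c hi⟩⟩
  · rintro (a | y) hv hc
    · have haV : a ∈ G.vertexSet := by
        rcases hv with ⟨a', ha', heq⟩ | hv
        · exact Sum.inl_injective heq ▸ ha'
        · rw [(inl_mem_image_glue.1 hv).2]
          exact h.mem_vertexSet i₀
      obtain ⟨j, hj, huniq⟩ := h.existsUnique a haV fun i hi => hc i (congrArg Sum.inl hi)
      refine ⟨Sum.inl j, ⟨a, hj, rfl⟩, ?_⟩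
      rintro (j' | t) hmem
      · exact congrArg Sum.inl (huniq j' (Sum.inl_injective.mem_set_image.1 hmem))
      · exact absurd (congrArg Sum.inl (inl_mem_image_glue.1 hmem).2.symm) (hc i₀)
    · have hyV : (y : β) ∈ H.vertexSet := by
        rcases hv with ⟨a', -, heq⟩ | hv
        · exact absurd heq (by simp)
        · exact inr_mem_image_glue.1 hv
      obtain ⟨t, ht, huniq⟩ := h'.existsUnique y hyV fun _ => y.2.symm
      refine ⟨Sum.inr t, inr_mem_image_glue.2 ht, ?_⟩
      rintro (j' | t') hmem
      · simp at hmem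
      · exact congrArg Sum.inr (huniq t' (inr_mem_image_glue.1 hmem))

end Coalescence

section Power

variable {V : Type*} {S : SimpleGraph V} {k : ℕ}

theorem isUniform_power (hk : 2 ≤ k) : (power S k).IsUniform k := by
  rintro _ ⟨⟨e, he⟩, rfl⟩
  have hcard : {v : V | v ∈ e}.ncard = 2 := by
    induction e using Sym2.ind with | _ a b => ?_
    have h1 : {v : V | v ∈ s(a, b)} = {a, b} := by ext; simp
    rw [h1, Set.ncard_pair (S.ne_of_adj he)]
  have hfin' : {v : V | v ∈ e}.Finite := Set.finite_of_ncard_ne_zero (by omega)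
  rw [Set.ncard_union_eq _ (hfin'.image _) (Set.finite_range _),
    Set.ncard_image_of_injective _ Sum.inl_injective, ← Set.image_univ,
    Set.ncard_image_of_injective, Set.ncard_univ, Nat.card_fin]
  · change {v : V | v ∈ e}.ncard + _ = _
    omega
  · intro i j hij
    simpa using hij
  · rw [Set.disjoint_left]
    rintro _ ⟨v, -, rfl⟩ ⟨j, hj⟩
    simp at hj

/-- A power of a graph whose edges are listed by `e`. -/
theorem isSkeleton_power {J : Type*} (hk : 3 ≤ k) (e : J ≃ S.edgeSet) :
    (power S k).IsSkeleton (Sum.inl : V → V ⊕ (S.edgeSet × Fin (k - 2)))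
      (fun j => Sum.inl '' {v : V | v ∈ (e j : Sym2 V)} ∪
        Set.range fun i : Fin (k - 2) => Sum.inr (e j, i))
      fun v j => v ∈ (e j : Sym2 V) := by
  refine ⟨fun _ => Set.mem_univ _, Sum.inl_injective, ?_, ?_, ?_, ?_⟩
  · intro j j' hjj
    -- As `k ≥ 3`, each edge has an added vertex of its own, which identifies it.
    have h0 : (Sum.inr (e j, ⟨0, by omega⟩) : V ⊕ (S.edgeSet × Fin (k - 2))) ∈
        Sum.inl '' {v : V | v ∈ (e j : Sym2 V)} ∪
        Set.range fun i : Fin (k - 2) => Sum.inr (e j, i) := Or.inr ⟨_, rfl⟩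
    dsimp only at hjj
    rw [hjj] at h0
    simpa [eq_comm] using h0
  · exact e.surjective.range_comp fun e : S.edgeSet => (Sum.inl '' {v : V | v ∈ (e : Sym2 V)} ∪
        Set.range fun i : Fin (k - 2) => Sum.inr (e, i) : Set (V ⊕ (S.edgeSet × Fin (k - 2))))
  · intro v j
    simp
  · rintro (v | ⟨f, i⟩) - hc
    · exact absurd rfl (hc v)
    · refine ⟨e.symm f, by simp, fun j hj => ?_⟩
      have : e j = f := by simpa using hj
      rw [← this, Equiv.symm_apply_apply]

end Power

end Hypergraph

/-! ### Existence of a maximizer -/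

namespace EdgeFamily

section Map

variable {V W : Type*} {E : Finset (Finset V)} {k m : ℕ}

theorem edgeSum_map (p : V ≃ W) (x : W → ℝ) :
    edgeSum (E.map (Finset.mapEmbedding p.toEmbedding).toEmbedding) x = edgeSum E (x ∘ p) := by
  simp [edgeSum, Finset.mapEmbedding_apply]

variable [Fintype V] [Fintype W]

theorem IsPerron.map (p : V ≃ W) {ρ : ℝ} {x : V → ℝ} (h : IsPerron E k ρ x) :
    IsPerron (E.map (Finset.mapEmbedding p.toEmbedding).toEmbedding) k ρ (x ∘ p.symm) := by
  refine ⟨fun v => h.nonneg _, ?_, fun y hy => ?_, ?_⟩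
  · intro h0
    refine h.ne_zero (funext fun v => ?_)
    simpa using congrFun h0 (p v)
  · rw [edgeSum_map, ← p.sum_comp]
    exact h.bound (y ∘ p) fun v => hy _
  · rw [edgeSum_map, ← p.sum_comp]
    simpa [Function.comp_def] using h.attained

theorem IsLinearBicyclic.map (p : V ≃ W) (h : IsLinearBicyclic E k m) :
    IsLinearBicyclic (E.map (Finset.mapEmbedding p.toEmbedding).toEmbedding) k m := by
  have hmem : ∀ e, e ∈ E.map (Finset.mapEmbedding p.toEmbedding).toEmbedding ↔
      ∃ f ∈ E, f.map p.toEmbedding = e := fun e => Finset.mem_map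
  refine ⟨h.nonempty.map p, ?_, ?_, ?_, ?_, ?_⟩
  · intro e he
    obtain ⟨f, hf, rfl⟩ := (hmem e).1 he
    rw [Finset.card_map, h.uniform f hf]
  · intro e he e' he' hne a ha ha' b hb hb'
    obtain ⟨f, hf, rfl⟩ := (hmem e).1 he
    obtain ⟨f', hf', rfl⟩ := (hmem e').1 he'
    rw [Finset.mem_map_equiv] at ha ha' hb hb'
    exact p.symm.injective (h.linear f hf f' hf' (fun hff => hne (hff ▸ rfl)) _ ha ha' _ hb hb')
  · intro a b
    have h1 := Relation.ReflTransGen.lift (p := Linked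
      (E.map (Finset.mapEmbedding p.toEmbedding).toEmbedding)) p (fun c d ⟨e, he, hc, hd⟩ =>
      ⟨_, (hmem _).2 ⟨e, he, rfl⟩, Finset.mem_map_of_mem p.toEmbedding hc,
        Finset.mem_map_of_mem p.toEmbedding hd⟩) _ _ (h.connected (p.symm a) (p.symm b))
    simpa [Function.onFun] using h1
  · rw [Finset.card_map, h.card_edges]
  · rw [← Fintype.card_congr p, h.card_vertices]

end Map

/-- There are finitely many families on `Fin n`, and each has at most one value. -/
theorem finite_values (n k : ℕ) :
    {ρ : ℝ | ∃ (E : Finset (Finset (Fin n))) (x : Fin n → ℝ), IsPerron E k ρ x}.Finite := by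
  classical
  refine (Set.finite_range fun E : Finset (Finset (Fin n)) =>
    if h : ∃ ρ, ∃ x : Fin n → ℝ, IsPerron E k ρ x then h.choose else 0).subset ?_
  rintro ρ ⟨E, x, hx⟩
  have h : ∃ ρ, ∃ x : Fin n → ℝ, IsPerron E k ρ x := ⟨ρ, x, hx⟩
  refine ⟨E, ?_⟩
  dsimp only
  rw [dif_pos h]
  obtain ⟨y, hy⟩ := h.choose_spec
  exact hy.value_unique hx

/-- The edges of a star with `m` edges, and an edge through leaves of three of them. -/
def sampleEdge (k m : ℕ) (hm : 3 ≤ m) :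
    Option (Fin m) → Finset (Option (Fin m × Fin (k + 2)) ⊕ Fin k)
  | none => (Finset.univ.image fun t : Fin 3 => Sum.inl (some (Fin.castLE hm t, 0))) ∪
      Finset.univ.image Sum.inr
  | some i => insert (Sum.inl none) (Finset.univ.image fun j => Sum.inl (some (i, j)))

/-- The parameters are shifted: the edges have `k + 3` vertices, and there are `m` star edges and
one more. That one meets three different star edges in one leaf each, which keeps linearity, and has
`k` new vertices. -/
theorem isLinearBicyclic_sample (k m : ℕ) (hm : 3 ≤ m) :
    IsLinearBicyclic (Finset.univ.image (sampleEdge k m hm)) (k + 3) (m + 1) := by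
  have hmem : ∀ e, e ∈ Finset.univ.image (sampleEdge k m hm) ↔ ∃ o, sampleEdge k m hm o = e :=
    fun e => by simp
  have hinj : Function.Injective (sampleEdge k m hm) := by
    rintro (_ | i) (_ | i') h
    · rfl
    · have : Sum.inl none ∈ sampleEdge k m hm none := h ▸ Finset.mem_insert_self _ _
      simp [sampleEdge] at this
    · have : Sum.inl none ∈ sampleEdge k m hm none := h ▸ Finset.mem_insert_self _ _
      simp [sampleEdge] at this
    · have : Sum.inl (some (i, 0)) ∈ sampleEdge k m hm (some i') := by
        rw [← h]; simp [sampleEdge]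
      simp only [sampleEdge, Finset.mem_insert, Sum.inl.injEq, reduceCtorEq, Finset.mem_image,
        Finset.mem_univ, true_and, Option.some.injEq, Prod.mk.injEq, false_or] at this
      obtain ⟨_, rfl, -⟩ := this
      rfl
  have hcenter : ∀ a, Relation.ReflTransGen (Linked (Finset.univ.image (sampleEdge k m hm))) a
      (Sum.inl none) ∧ Relation.ReflTransGen (Linked (Finset.univ.image (sampleEdge k m hm)))
      (Sum.inl none) a := by
    have h1 : ∀ i j, Relation.ReflTransGen (Linked (Finset.univ.image (sampleEdge k m hm)))
        (Sum.inl (some (i, j))) (Sum.inl none) ∧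
        Relation.ReflTransGen (Linked (Finset.univ.image (sampleEdge k m hm))) (Sum.inl none)
        (Sum.inl (some (i, j))) := fun i j =>
      ⟨.single ⟨_, (hmem _).2 ⟨some i, rfl⟩, by simp [sampleEdge], by simp [sampleEdge]⟩,
        .single ⟨_, (hmem _).2 ⟨some i, rfl⟩, by simp [sampleEdge], by simp [sampleEdge]⟩⟩
    rintro ((_ | ⟨i, j⟩) | l)
    · exact ⟨.refl, .refl⟩
    · exact h1 i j
    · have h2 := h1 (Fin.castLE hm 0) 0
      exact ⟨.head ⟨_, (hmem _).2 ⟨none, rfl⟩, by simp [sampleEdge], by simp [sampleEdge]⟩ h2.1,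
        h2.2.tail ⟨_, (hmem _).2 ⟨none, rfl⟩, by simp [sampleEdge], by simp [sampleEdge]⟩⟩
  refine ⟨⟨Sum.inl none⟩, ?_, ?_, fun a b => (hcenter a).1.trans (hcenter b).2, ?_, ?_⟩
  · intro e he
    obtain ⟨_ | i, rfl⟩ := (hmem e).1 he
    · rw [sampleEdge, Finset.card_union_of_disjoint, Finset.card_image_of_injective,
        Finset.card_image_of_injective _ Sum.inr_injective]
      · simp [add_comm]
      · intro s t h
        simpa using h
      · rw [Finset.disjoint_left]
        simp
    · rw [sampleEdge, Finset.card_insert_of_notMem (by simp), Finset.card_image_of_injective]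
      · simp
      · intro s t h
        simpa using h
  · intro e he e' he' hne
    obtain ⟨o, rfl⟩ := (hmem e).1 he
    obtain ⟨o', rfl⟩ := (hmem e').1 he'
    have hoo : o ≠ o' := fun h => hne (h ▸ rfl)
    rcases o with _ | i <;> rcases o' with _ | i'
    · exact absurd rfl hoo
    · rintro ((_ | ⟨i₁, j₁⟩) | l) ha ha' ((_ | ⟨i₂, j₂⟩) | l') hb hb' <;>
        simp_all [sampleEdge]
    · rintro ((_ | ⟨i₁, j₁⟩) | l) ha ha' ((_ | ⟨i₂, j₂⟩) | l') hb hb' <;>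
        simp_all [sampleEdge]
    · rintro ((_ | ⟨i₁, j₁⟩) | l) ha ha' ((_ | ⟨i₂, j₂⟩) | l') hb hb' <;>
        simp_all [sampleEdge]
  · rw [Finset.card_image_of_injective _ hinj]
    simp
  · simp only [Fintype.card_sum, Fintype.card_option, Fintype.card_prod, Fintype.card_fin]
    rw [show k + 3 - 1 = k + 2 by omega]
    ring

end EdgeFamily

namespace Hypergraph

open EdgeFamily

/-- There is a linear bicyclic hypergraph. -/
theorem exists_isLinearBicyclic (k m : ℕ) (hk : 3 ≤ k) (hm : 4 ≤ m) :
    ∃ (α : Type u) (G : Hypergraph α), G.IsLinearBicyclic k m := by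
  obtain ⟨k, rfl⟩ : ∃ j, k = j + 3 := ⟨k - 3, by omega⟩
  obtain ⟨m, rfl⟩ : ∃ j, m = j + 1 := ⟨m - 1, by omega⟩
  set W := Option (Fin m × Fin (k + 2)) ⊕ Fin k
  -- An edgeless carrier in the required universe, to be given the transported sample edges.
  set G₀ : Hypergraph (ULift.{u} W) := ⟨Set.univ, ∅, by simp⟩
  let _ : Fintype G₀.vertexSet := inferInstanceAs (Fintype (Set.univ : Set (ULift.{u} W)))
  have h := (isLinearBicyclic_sample k m (by omega)).map
    (Equiv.ulift.symm.trans (Equiv.Set.univ (ULift.{u} W)).symm)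
  have h' : ∀ E : Finset (Finset G₀.vertexSet), EdgeFamily.IsLinearBicyclic E (k + 3) (m + 1) →
      (G₀.withFamily E).IsLinearBicyclic (k + 3) (m + 1) := fun E hE =>
    (isLinearBicyclic_iff (by omega)).2 (by rw [edgeFamily_withFamily]; exact hE)
  exact ⟨_, _, h' _ h⟩

/-- Every competitor has `m * (k - 1) - 1` vertices, so its family can be carried to one fixed `Fin
n` and the set of radii is finite. -/
theorem exists_isMaximizingLinearBicyclic (k m : ℕ) (hk : 3 ≤ k) (hm : 4 ≤ m) :
    ∃ (α : Type u) (G : Hypergraph α) (_ : Finite G.vertexSet),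
      G.IsMaximizingLinearBicyclic k m := by
  set S : Set ℝ := {r | ∃ (α : Type u) (G : Hypergraph α) (_ : Finite G.vertexSet),
    G.IsLinearBicyclic k m ∧ G.spectralRadius k = r} with hS
  have hfin : S.Finite := by
    refine (finite_values (m * (k - 1) - 1) k).subset ?_
    rintro r ⟨α, G, hGf, hG, rfl⟩
    have := Fintype.ofFinite G.vertexSet
    have hlb := (isLinearBicyclic_iff (by omega)).1 hG
    have := hlb.nonempty
    obtain ⟨ρ, x, hx⟩ := exists_isPerron (by omega : k ≠ 0) hlb.uniform
    rw [spectralRadius_eq (by omega) hlb.uniform hx]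
    have hcard := hlb.card_vertices
    exact ⟨_, _, hx.map (Fintype.equivFinOfCardEq (by omega))⟩
  have hne : S.Nonempty := by
    obtain ⟨α, G, hG⟩ := exists_isLinearBicyclic.{u} k m hk hm
    exact ⟨_, α, G, hG.finite.to_subtype, hG, rfl⟩
  obtain ⟨r, ⟨α, G, hGf, hG, rfl⟩, hmax⟩ := Set.exists_max_image S id hfin hne
  exact ⟨α, G, hGf, hG, fun β H hHf hH => hmax _ ⟨β, H, hHf, hH, rfl⟩⟩

/-! ### The named hypergraphs and the conclusion -/

theorem isUniform_G5 {k : ℕ} (hk : 3 ≤ k) : (G5 k).IsUniform k := by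
  rintro e (rfl | ⟨i, rfl⟩)
  · rw [Set.ncard_union_eq _ (Set.finite_range _) (Set.finite_range _), ← Set.image_univ,
      ← Set.image_univ, Set.ncard_image_of_injective, Set.ncard_image_of_injective, Set.ncard_univ,
      Set.ncard_univ, Nat.card_fin, Nat.card_fin]
    · omega
    · intro i j h; simpa using h
    · intro i j h; simpa using h
    · rw [Set.disjoint_left]
      rintro _ ⟨i, rfl⟩ ⟨j, h⟩
      simp at h
  · rw [Set.ncard_union_eq _ (Set.toFinite _) (Set.finite_range _), Set.ncard_pair (by simp),
      ← Set.image_univ, Set.ncard_image_of_injective, Set.ncard_univ, Nat.card_fin]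
    · omega
    · intro i j h; simpa using h
    · rw [Set.disjoint_left]
      rintro _ (rfl | rfl) ⟨j, h⟩ <;> simp at h

theorem isSkeleton_G5 (k : ℕ) : (G5 k).IsSkeleton
    (fun o : Option (Fin 3) => o.elim G5Vertex.w G5Vertex.v)
    (fun o : Option (Fin 3) => o.elim (Set.range G5Vertex.v ∪ Set.range G5Vertex.core)
      fun i => {G5Vertex.w, G5Vertex.v i} ∪ Set.range (G5Vertex.spoke i)) incG5 := by
  have hmem : ∀ o o' : Option (Fin 3), o.elim (G5Vertex.w (k := k)) G5Vertex.v ∈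
      (o'.elim (Set.range G5Vertex.v ∪ Set.range G5Vertex.core)
      fun i => {G5Vertex.w, G5Vertex.v i} ∪ Set.range (G5Vertex.spoke i)) ↔ incG5 o o' := by
    rintro (_ | i) (_ | j) <;> simp [incG5]
  refine ⟨fun _ => Set.mem_univ _, ?_, ?_, ?_, hmem, ?_⟩
  · rintro (_ | i) (_ | j) h <;> simp_all
  · rintro (_ | i) (_ | j) h
    · rfl
    · have h1 := hmem none (some j)
      dsimp only at h
      rw [← h, hmem] at h1
      exact absurd trivial (h1.not.1 id)
    · have h1 := hmem none (some i)
      dsimp only at h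
      rw [h, hmem] at h1
      exact absurd trivial (h1.not.1 id)
    · have h1 := hmem (some i) (some i)
      dsimp only at h
      rw [h, hmem] at h1
      exact congrArg some (h1.2 rfl)
  · ext e
    constructor
    · rintro ⟨_ | i, rfl⟩
      · exact Or.inl rfl
      · exact Or.inr ⟨i, rfl⟩
    · rintro (rfl | ⟨i, rfl⟩)
      · exact ⟨none, rfl⟩
      · exact ⟨some i, rfl⟩
  · rintro (_ | i | j | ⟨i, j⟩) - hc
    · exact absurd rfl (hc none)
    · exact absurd rfl (hc (some i))
    · refine ⟨none, by simp, ?_⟩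
      rintro (_ | i) h
      · rfl
      · simp at h
    · refine ⟨some i, by simp, ?_⟩
      rintro (_ | i') h
      · simp at h
      · simp only [Option.elim_some, Set.mem_union, Set.mem_insert_iff, reduceCtorEq,
          Set.mem_singleton_iff, or_self, Set.mem_range, G5Vertex.spoke.injEq, false_or] at h
        obtain ⟨_, rfl, -⟩ := h
        rfl

theorem isSkeleton_G10 {k : ℕ} (hk : 3 ≤ k) :
    ∃ g, (G10 k).IsSkeleton Sum.inl g incDiamond := by
  have hmem : ∀ j, diamondEdge j ∈ diamond.edgeSet := by
    intro j
    fin_cases j <;> simp [diamondEdge, diamond]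
  have hbij : Function.Bijective fun j => (⟨diamondEdge j, hmem j⟩ : diamond.edgeSet) := by
    constructor
    · intro i j hij
      have h : diamondEdge i = diamondEdge j := congrArg Subtype.val hij
      clear hij
      revert i j
      decide
    · rintro ⟨e, he⟩
      induction e using Sym2.ind with | _ a b => ?_
      suffices h : ∃ j, diamondEdge j = s(a, b) from h.imp fun j hj => Subtype.ext hj
      simp only [diamond, SimpleGraph.mem_edgeSet, SimpleGraph.deleteEdges_adj,
        SimpleGraph.top_adj, Set.mem_singleton_iff] at he
      revert a b
      decide
  exact ⟨_, isSkeleton_power hk (Equiv.ofBijective _ hbij)⟩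

/-- Only the center is kept in the skeleton: the leaves of the star have degree one and count as
remaining vertices. -/
theorem isSkeleton_hyperstar {k : ℕ} (hk : 3 ≤ k) (s : ℕ) :
    ∃ g : Fin s → Set _, (hyperstar k s).IsSkeleton (fun _ : Unit => hyperstarCenter k s) g
      fun _ _ => True := by
  have hbij : Function.Bijective fun t : Fin s =>
      (⟨s(Sum.inl 0, Sum.inr t), by simp⟩ : (completeBipartiteGraph (Fin 1) (Fin s)).edgeSet) := by
    constructor
    · intro t t' h
      simpa using h
    · rintro ⟨e, he⟩
      induction e using Sym2.ind with | _ a b => ?_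
      rcases a with a | a <;> rcases b with b | b
      · simp at he
      · obtain rfl := Subsingleton.elim a 0
        exact ⟨b, rfl⟩
      · obtain rfl := Subsingleton.elim b 0
        exact ⟨a, Subtype.ext Sym2.eq_swap⟩
      · simp at he
  have h := isSkeleton_power hk (Equiv.ofBijective _ hbij)
  refine ⟨_, fun _ => Set.mem_univ _, fun _ _ _ => rfl, h.injective_edge, h.range_eq,
    fun _ t => ?_, ?_⟩
  · simp [hyperstarCenter]
  · rintro v hv hc
    by_cases hv' : ∃ w, Sum.inl w = v
    · obtain ⟨i | t, rfl⟩ := hv'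
      · exact absurd (by rw [hyperstarCenter, Subsingleton.elim i 0]) (hc ())
      · refine ⟨t, (h.mem_iff _ _).2 (by simp), fun t' ht' => ?_⟩
        have := (h.mem_iff _ _).1 ht'
        simpa [eq_comm] using this
    · exact h.existsUnique v hv fun w hw => hv' ⟨w, hw⟩

/-- A uniform hypergraph whose family has a star skeleton is obtained by attaching a hyperstar. -/
theorem isIsomorphic_attachHyperstar {α β I J : Type*} [Fintype J] {k s : ℕ} (hk : 3 ≤ k)
    {G : Hypergraph α} [Fintype G.vertexSet] {c : I → G.vertexSet} {g : J → Finset G.vertexSet}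
    {inc : I → J → Prop} {i₀ : I} (h : IsStarSkeleton G.edgeFamily c g inc i₀)
    (hG : G.IsUniform k) (hcard : G.edgeFamily.card - Fintype.card J = s)
    {H : Hypergraph β} {c' : I → β} {g' : J → Set β} (h' : H.IsSkeleton c' g' inc)
    (hH : H.IsUniform k) : G.IsIsomorphic (attachHyperstar H (c' i₀) k s) := by
  obtain ⟨g₁, hg₁⟩ := h.exists_isSkeleton hcard
  obtain ⟨g₂, hg₂⟩ := isSkeleton_hyperstar hk s
  have hstar : (hyperstar k s).IsUniform k := isUniform_power (by omega)
  exact hg₁.isIsomorphic (by omega) (h'.coalescence hg₂ (by omega) hstar i₀) hG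
    (hH.coalescence hstar)

end Hypergraph

theorem mainTheorem2 (k m : ℕ) (hk : 3 ≤ k) (hm : 5 ≤ m) :
    (∃ (α : Type u) (G : Hypergraph α) (_ : Finite G.vertexSet),
      G.IsMaximizingLinearBicyclic k m) ∧
    ∀ (α : Type u) (G : Hypergraph α) [Finite G.vertexSet],
      G.IsMaximizingLinearBicyclic k m →
        G.IsIsomorphic (Hypergraph.BL1 k m) ∨
        G.IsIsomorphic (Hypergraph.BL2 k m) ∨
        G.IsIsomorphic (Hypergraph.BP k m) := by
  refine ⟨Hypergraph.exists_isMaximizingLinearBicyclic k m hk (by omega), fun α G _ hG => ?_⟩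
  classical
  have := Fintype.ofFinite G.vertexSet
  have hlb := (Hypergraph.isLinearBicyclic_iff (by omega)).1 hG.1
  have := hlb.nonempty
  obtain ⟨ρ, x, hx⟩ := EdgeFamily.exists_isPerron (by omega : k ≠ 0) hlb.uniform
  have hmax : EdgeFamily.IsMaximal G.edgeFamily k m ρ x :=
    ⟨hlb, hx, fun E ρ' y hE hy => hG.value_le (by omega) hE hx hy⟩
  have hcard := hlb.card_edges
  -- The skeleton has four edges in the first two cases and five in the third, which leaves `m - 4`
  -- or `m - 5` edges for the hyperstar.
  rcases hmax.exists_isStarSkeleton hk with ⟨c, g, h⟩ | ⟨c, g, h⟩ | ⟨c, g, h⟩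
  · exact Or.inl (Hypergraph.isIsomorphic_attachHyperstar hk h hG.1.uniform (by simp [hcard])
      (Hypergraph.isSkeleton_G5 k) (Hypergraph.isUniform_G5 hk))
  · exact Or.inr (Or.inl (Hypergraph.isIsomorphic_attachHyperstar hk h hG.1.uniform
      (by simp [hcard]) (Hypergraph.isSkeleton_G5 k) (Hypergraph.isUniform_G5 hk)))
  · obtain ⟨g', hg'⟩ := Hypergraph.isSkeleton_G10 hk
    exact Or.inr (Or.inr (Hypergraph.isIsomorphic_attachHyperstar hk h hG.1.uniform
      (by simp [hcard]) hg' (Hypergraph.isUniform_power (by omega))))
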